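/- **Setting.** Let $f=f_1+f_2$ and $g=g_1+g_2$ on $\mathbb R^n$, where $f_1,g_1:\mathbb R^n\to\mathbb R$ are convex and continuously differentiable with $L_{f_1}$-, $L_{g_1}$-Lipschitz gradients, $f_2,g_2:\mathbb R^n\to\mathbb R\cup\{\infty\}$ are proper, lower semicontinuous and convex, and $f_2$ is $l_{f_2}$-Lipschitz on its domain. Put $X=\operatorname{dom}f\cap\operatorname{dom}g$, $f^*=\inf_X f>-\infty$, $g^*=\inf_X g>-\infty$, $p^*=\inf\{f(x):x\in\arg\min g\}$. Assume $p^*-f^*\ge\Delta$ for some $\Delta>0$, and that $\arg\min g$ is non-empty and not a singleton. For $c\in\mathbb R$ let $f_c=f-c$ and $\bar g(c)=\min\{g(x): f_c(x)\le 0\}$. A point $x$ is an $\epsilon$-optimal solution of $\min\{g: f\le c\}$ if $g(x)-\bar g(c)\le\epsilon$ and $[f_c(x)]_+\le\epsilon$. Given $\epsilon>0$, let $x^0$ satisfy $f(x^0)\le f^*+\epsilon$ and $f_c(x^0)<-\Delta_1$, where $\Delta_1>0$ does not depend on $\epsilon$; let $\tilde x_g$ satisfy $g(\tilde x_g)\le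 g^*+\epsilon$ with $u_0=f(\tilde x_g)<\infty$ and $c\le u_0$. Let $\gamma_1>1$, $\gamma_2\ge1$, $L_{\min}>0$ and put $$D_z=\frac{g(x^0)-g(\tilde x_g)+1}{\Delta_1},\quad L=L_{g_1}+2D_zL_{f_1}+1,\quad D_0=g(x^0)+\max\{0,-2D_zf^*\}+2D_z|u_0|.$$ Let $R_1$ be the diameter of $\{g\le D_0\}$, $D_{\mathcal L}=D_0+\gamma_1LR_1^2$, $D_g$ the diameter of $\{g\le D_{\mathcal L}\}$ (both level sets are assumed bounded), $B_f=\max_{g(x)\le D_{\mathcal L}}\|\nabla f_1(x)\|+l_{f_2}$, and $$D=(1+D_g(1+D_g))\max\{B_f,\;2D_zB_f+2D_zB_f^2\}.$$ Use the tolerances $\epsilon_1=\epsilon_4=\epsilon^2/D$, $\epsilon_2=B_f\epsilon/D$, $\epsilon_3=(2D_zB_f+2D_zB_f^2)\epsilon/D$. **Algorithms.** For $z\ge 0$, $\mathrm{APG}(z,y)$ is the following accelerated proximal gradient method, applied to $\varphi=\varphi_1+\varphi_2$ with $\varphi_1=g_1+\frac\epsilon2\|\cdot-x^0\|^2+zf_1$,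 $\varphi_2=g_2+zf_2$ ($\varphi_2=g_2$ if $z=0$), and $\mu=\epsilon$. A *backtracking step* from a base point $y$ with initial constant $\ell$ tries $\ell,\gamma_1\ell,\gamma_1^2\ell,\dots$ as the constant $\ell'$, and takes the first one for which $x=\mathrm{prox}_{\varphi_2/\ell'}(y-\frac1{\ell'}\nabla\varphi_1(y))$ satisfies $\varphi_1(x)\le\varphi_1(y)+\langle\nabla\varphi_1(y),x-y\rangle+\frac{\ell'}2\|x-y\|^2$. A backtracking step from the starting point $y$ with initial constant $L_{\min}$ gives $x_0$ and a constant $\tilde L$; put $x_{-1}=x_0$, $L_0=\max\{L_{\min},\tilde L/\gamma_2\}$, $\alpha_{-1}=1$. For $k=0,1,\dots$: backtrack with initial constant $L_k$, where the base point for the trial constant $\ell'$ is $x_k+\frac{\alpha_k(1-\alpha_{k-1})}{\alpha_{k-1}(1+\alpha_k)}(x_k-x_{k-1})$ with $\alpha_k=\sqrt{\mu/\ell'}$, to get $x_{k+1}$ and the accepted constant $\tilde L$ (which fixes $\alpha_k$); backtrack from $x_{k+1}$ with initial constant $\tilde L$ to get $\hat x$; return $\hat x$ if $\mathrm{dist}(0,\partial\varphi(\hat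 x))\le\epsilon_1$, and otherwise continue with $L_{k+1}=\max\{L_{\min},\tilde L/\gamma_2\}$. *Interval search* (Algorithm 3) with $\sigma\in(0,2D_z]$: compute $\hat x$ by $\mathrm{APG}$ with $z=0$; if $[f_c(\hat x)]_+\le\epsilon_2$, return $Z=\{0\}$. Otherwise set $a=0$, $b=\sigma$ and compute $\hat x$ with $z=b$; while $[f_c(\hat x)]_+>\epsilon_2$ and $b\le D_z$, replace $(a,b)$ by $(b,2b)$ and compute $\hat x$ with $z=b$. Return $Z=\{b\}$ if $|bf_c(\hat x)|\le\epsilon_3$, and $Z=[a,b]$ otherwise. Every call of APG after the first starts from the last $\hat x$. *Bisection* (Algorithm 4), started with the interval $[a,b]=Z$ and the point $\hat x_b$ that the interval search computed for $b$: while $b-a>\epsilon_4$, let $e=\frac{a+b}2$ and compute $\hat x$ by $\mathrm{APG}$ with $z=e$, started from the last $\hat x$; if $[f_c(\hat x)]_+>\epsilon_2$ set $a=e$; else if $|ef_c(\hat x)|\le\epsilon_3$ return $(\hat x,e)$; else set $b=e$, $\hat x_b=\hat x$. At the end of the loop return $(\hat x_b,b)$. One evaluation of $\varphi_1$, $\varphi_2$,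 $\nabla\varphi_1$ or of a proximal mapping of $\varphi_2$ is one oracle query. **Statement.** For all $\gamma_1>1,\gamma_2\ge1$ and $\rho$ there is a constant $C$ such that for every problem as above, every $L_{\min}>0$, $c$, $\Delta_1>0$ and $\Gamma\in\mathbb R$ there is $\bar\epsilon>0$ with the following property. Let $0<\epsilon\le\bar\epsilon$, let $x^0,\tilde x_g$ be as above with $g(x^0)\le\Gamma$, and suppose that $L\le\rho L_{\min}$ and $L_{\min}\le\rho L$. Let the interval search and the bisection have arbitrary starting points in $\{g\le D_{\mathcal L}\}$. Then the interval search terminates, and Algorithm 4, applied to its output, terminates and returns an $\epsilon$-optimal solution of $\min\{g:f\le c\}$ after at most $$C\sqrt{\frac{L_{g_1}+2D_zL_{f_1}+1}{\epsilon}}\;|\log\epsilon|^2$$ oracle queries. -/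

import Mathlib

open scoped NNReal ENNReal

noncomputable section

namespace SimpleBilevel

/-- The space `ℝⁿ` with the Euclidean norm. -/
abbrev Sp (n : ℕ) : Type := EuclideanSpace ℝ (Fin n)

variable {n : ℕ}

/-! ### Extended-real-valued convex functions -/

/-- Effective domain of an extended-real-valued function. -/
def edom (ψ : Sp n → EReal) : Set (Sp n) := {x | ψ x ≠ ⊤}

/-- Level set `Lev_ψ(r) = {x : ψ x ≤ r}`. -/
def lev (ψ : Sp n → EReal) (r : ℝ) : Set (Sp n) := {x | ψ x ≤ (r : EReal)}

/-- `ψ : ℝⁿ → ℝ ∪ {∞}` is proper, convex (convex epigraph) and lower semicontinuous. -/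
structure ProperConvexLsc (ψ : Sp n → EReal) : Prop where
  ne_bot : ∀ x, ψ x ≠ ⊥
  nonempty_dom : (edom ψ).Nonempty
  convex : Convex ℝ {p : Sp n × ℝ | ψ p.1 ≤ (p.2 : EReal)}
  lsc : LowerSemicontinuous ψ

/-- The convex subdifferential of `ψ` at `x`. -/
def subdiff (ψ : Sp n → EReal) (x : Sp n) : Set (Sp n) :=
  {v | ∀ y, ψ x + ((inner ℝ v (y - x) : ℝ) : EReal) ≤ ψ y}

/-- `p = prox_{tψ}(y)`, i.e. `p` minimizes `ψ + ‖· - y‖² / (2t)`. -/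
def IsProx (ψ : Sp n → EReal) (t : ℝ) (y p : Sp n) : Prop :=
  ∀ u, ψ p + ((‖p - y‖ ^ 2 / (2 * t) : ℝ) : EReal) ≤ ψ u + ((‖u - y‖ ^ 2 / (2 * t) : ℝ) : EReal)

/-! ### The accelerated proximal gradient method -/

/-- Acceptance test of a backtracking step from `y` to `x` with constant `L`. -/
def Descent (φ₁ : Sp n → ℝ) (y x : Sp n) (L : ℝ) : Prop :=
  φ₁ x ≤ φ₁ y + inner ℝ (gradient φ₁ y) (x - y) + L / 2 * ‖x - y‖ ^ 2

/-- Backtracking. The trial constants are `L, γL, γ²L, …`; the trial with constant `L` makes a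
proximal gradient step from the base point `y L` (which may depend on the trial constant).
`Backtrack φ₁ φ₂ γ y L L' x m`: starting with the constant `L`, the first accepted trial is the
`m`-th one; its constant is `L'` and its point is `x`. -/
inductive Backtrack (φ₁ : Sp n → ℝ) (φ₂ : Sp n → EReal) (γ : ℝ) (y : ℝ → Sp n) :
    ℝ → ℝ → Sp n → ℕ → Prop
  | accept {L : ℝ} {x : Sp n}
      (hx : IsProx φ₂ (1 / L) (y L - (1 / L) • gradient φ₁ (y L)) x)
      (hd : Descent φ₁ (y L) x L) :
      Backtrack φ₁ φ₂ γ y L L x 1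
  | reject {L L' : ℝ} {x x' : Sp n} {m : ℕ}
      (hx : IsProx φ₂ (1 / L) (y L - (1 / L) • gradient φ₁ (y L)) x)
      (hd : ¬ Descent φ₁ (y L) x L)
      (hrec : Backtrack φ₁ φ₂ γ y (γ * L) L' x' m) :
      Backtrack φ₁ φ₂ γ y L L' x' (m + 1)

/-- The extrapolated point for the trial constant `L`, with `α = √(μ / L)`, from the current
iterate `x`, the previous iterate `xp` and the previous momentum parameter `αp`. -/
def extrapolate (μ : ℝ) (x xp : Sp n) (αp L : ℝ) : Sp n :=
  x + ((√(μ / L) * (1 - αp)) / (αp * (1 + √(μ / L)))) • (x - xp)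

/-- Stopping test `dist(0, ∂(φ₁ + φ₂)(x)) ≤ tol`. The distance to the empty set is `∞`. -/
def NearStationary (φ₁ : Sp n → ℝ) (φ₂ : Sp n → EReal) (tol : ℝ) (x : Sp n) : Prop :=
  Metric.infEDist 0 (subdiff (fun u => (φ₁ u : EReal) + φ₂ u) x) ≤ ENNReal.ofReal tol

/-- The main loop of the method. The state `(x, xp, L, αp)` consists of the current and the
previous iterate, the first trial constant `L_k` and the previous momentum parameter.
`APGLoop φ₁ φ₂ γ₁ γ₂ Lmin μ tol x xp L αp out N`: the loop started in this state halts and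
returns `out` after `N` oracle queries.

Each single evaluation of `φ₁`, `φ₂`, `∇φ₁`, `prox φ₂` is one query: a backtracking trial from `y`
to `x` costs four (`∇φ₁ y`, the proximal point `x`, `φ₁ y`, `φ₁ x`), and a stopping test one more
(`∇φ₁` at the tested point). -/
inductive APGLoop (φ₁ : Sp n → ℝ) (φ₂ : Sp n → EReal) (γ₁ γ₂ Lmin μ tol : ℝ) :
    Sp n → Sp n → ℝ → ℝ → Sp n → ℕ → Prop
  | halt {x xp xt xh : Sp n} {L αp Lt Lh : ℝ} {m m' : ℕ}
      (h₁ : Backtrack φ₁ φ₂ γ₁ (extrapolate μ x xp αp) L Lt xt m)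
      (h₂ : Backtrack φ₁ φ₂ γ₁ (fun _ => xt) Lt Lh xh m')
      (ht : NearStationary φ₁ φ₂ tol xh) :
      APGLoop φ₁ φ₂ γ₁ γ₂ Lmin μ tol x xp L αp xh (4 * m + 4 * m' + 1)
  | next {x xp xt xh out : Sp n} {L αp Lt Lh : ℝ} {m m' N : ℕ}
      (h₁ : Backtrack φ₁ φ₂ γ₁ (extrapolate μ x xp αp) L Lt xt m)
      (h₂ : Backtrack φ₁ φ₂ γ₁ (fun _ => xt) Lt Lh xh m')
      (ht : ¬ NearStationary φ₁ φ₂ tol xh)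
      (hrec : APGLoop φ₁ φ₂ γ₁ γ₂ Lmin μ tol xt x (max Lmin (Lt / γ₂)) (√(μ / Lt)) out N) :
      APGLoop φ₁ φ₂ γ₁ γ₂ Lmin μ tol x xp L αp out (4 * m + 4 * m' + 1 + N)

/-- `out = APG_μ(φ₁, φ₂, Lmin, μ, γ₁, γ₂, y₀, tol)`, computed with `N` oracle queries. -/
def APG (φ₁ : Sp n → ℝ) (φ₂ : Sp n → EReal) (Lmin μ γ₁ γ₂ : ℝ) (y₀ : Sp n) (tol : ℝ)
    (out : Sp n) (N : ℕ) : Prop :=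
  ∃ (L : ℝ) (x₀ : Sp n) (m M : ℕ),
    Backtrack φ₁ φ₂ γ₁ (fun _ => y₀) Lmin L x₀ m ∧
    APGLoop φ₁ φ₂ γ₁ γ₂ Lmin μ tol x₀ x₀ (max Lmin (L / γ₂)) 1 out M ∧
    N = 4 * m + M

/-! ### The simple bilevel problem `min f₁ + f₂` over `argmin (g₁ + g₂)` -/

/-- The functions and Lipschitz constants of the problem. -/
structure Problem (n : ℕ) where
  f₁ : Sp n → ℝ
  f₂ : Sp n → EReal
  g₁ : Sp n → ℝ
  g₂ : Sp n → EReal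
  Lf₁ : ℝ≥0
  Lg₁ : ℝ≥0
  lf₂ : ℝ≥0

namespace Problem

variable (P : Problem n)

/-- The upper-level objective. -/
def f (x : Sp n) : EReal := (P.f₁ x : EReal) + P.f₂ x

/-- The lower-level objective. -/
def g (x : Sp n) : EReal := (P.g₁ x : EReal) + P.g₂ x

/-- `X = dom f ∩ dom g`. -/
def X : Set (Sp n) := edom P.f ∩ edom P.g

/-- `f^* = inf_X f`. -/
def fStar : EReal := ⨅ x ∈ P.X, P.f x

/-- `g^* = inf_X g`. -/
def gStar : EReal := ⨅ x ∈ P.X, P.g x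

/-- The solution set of the lower-level problem. -/
def solG : Set (Sp n) := {x | ∀ y, P.g x ≤ P.g y}

/-- The optimal value `p^*` of the bilevel problem. -/
def pStar : EReal := ⨅ x ∈ P.solG, P.f x

/-- `f_c = f - c`. -/
def fc (c : ℝ) (x : Sp n) : EReal := P.f x - (c : EReal)

/-- The value function `ḡ(c) = inf {g x : f_c x ≤ 0}`. -/
def gBar (c : ℝ) : EReal := ⨅ x ∈ {x | P.fc c x ≤ 0}, P.g x

/-- `x` is an `ε`-optimal solution of `min g` subject to `f_c ≤ 0`. -/
def IsEpsOptimal (c ε : ℝ) (x : Sp n) : Prop :=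
  P.g x - P.gBar c ≤ (ε : EReal) ∧ max (P.fc c x) 0 ≤ (ε : EReal)

/-- The basic assumptions on the functions. That the proximal mappings of `g₂ + z f₂` can be
computed is part of the oracle model and not a hypothesis. -/
structure Basic : Prop where
  f₁_convex : ConvexOn ℝ Set.univ P.f₁
  f₁_contDiff : ContDiff ℝ 1 P.f₁
  f₁_lip : LipschitzWith P.Lf₁ (gradient P.f₁)
  g₁_convex : ConvexOn ℝ Set.univ P.g₁
  g₁_contDiff : ContDiff ℝ 1 P.g₁
  g₁_lip : LipschitzWith P.Lg₁ (gradient P.g₁)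
  f₂_pcl : ProperConvexLsc P.f₂
  g₂_pcl : ProperConvexLsc P.g₂
  f₂_lip : LipschitzOnWith P.lf₂ (fun x => (P.f₂ x).toReal) (edom P.f₂)
  fStar_ne_bot : P.fStar ≠ ⊥
  gStar_ne_bot : P.gStar ≠ ⊥
  gap : ∃ Δ : ℝ, 0 < Δ ∧ P.fStar + (Δ : EReal) ≤ P.pStar
  solG_nontrivial : P.solG.Nontrivial

end Problem

/-- All data on which the algorithms run: the problem, the parameters `γ₁, γ₂, Lmin` of the
accelerated proximal gradient method, the level `c` and the constant `Δ₁` of the regularity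
condition, the accuracy `ε`, the prox-center `x⁰` (an approximate minimizer of `f`) and an
approximate minimizer `x̃_g` of `g`. -/
structure Setup (n : ℕ) where
  P : Problem n
  γ₁ : ℝ
  γ₂ : ℝ
  Lmin : ℝ
  c : ℝ
  Δ₁ : ℝ
  ε : ℝ
  x0 : Sp n
  xg : Sp n

namespace Setup

variable (S : Setup n)

/-- `D_z = (g(x⁰) - g(x̃_g) + 1) / Δ₁`. -/
def Dz : ℝ := ((S.P.g S.x0).toReal - (S.P.g S.xg).toReal + 1) / S.Δ₁

/-- `L_{φ₁} = L_{g₁} + 2 D_z L_{f₁} + 1`. -/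
def Lphi : ℝ := S.P.Lg₁ + 2 * S.Dz * S.P.Lf₁ + 1

/-- `u₀ = f(x̃_g)`. -/
def u₀ : ℝ := (S.P.f S.xg).toReal

/-- `D₀ = g(x⁰) + max {0, -2 D_z f^*} + 2 D_z |u₀|`. -/
def D₀ : ℝ := (S.P.g S.x0).toReal + max 0 (-2 * S.Dz * S.P.fStar.toReal) + 2 * S.Dz * |S.u₀|

/-- `R₁`, the diameter of `Lev_g(D₀)`. -/
def R₁ : ℝ := Metric.diam (lev S.P.g S.D₀)

/-- `D_{L_z} = D₀ + γ₁ L_{φ₁} R₁²`. -/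
def DL : ℝ := S.D₀ + S.γ₁ * S.Lphi * S.R₁ ^ 2

/-- `D_g`, the diameter of `Lev_g(D_{L_z})`. -/
def Dg : ℝ := Metric.diam (lev S.P.g S.DL)

/-- `B_f = max {‖∇f₁ x‖ : x ∈ Lev_g(D_{L_z})} + l_{f₂}`. -/
def Bf : ℝ := sSup ((fun x => ‖gradient S.P.f₁ x‖) '' lev S.P.g S.DL) + S.P.lf₂

/-- `D = (1 + D_g (1 + D_g)) max {B_f, 2 D_z B_f + 2 D_z B_f²}`. -/
def D : ℝ := (1 + S.Dg * (1 + S.Dg)) * max S.Bf (2 * S.Dz * S.Bf + 2 * S.Dz * S.Bf ^ 2)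

/-- The tolerance `ε₁ = ε² / D`. -/
def ε₁ : ℝ := S.ε ^ 2 / S.D

/-- The tolerance `ε₂ = B_f ε / D`. -/
def ε₂ : ℝ := S.Bf * S.ε / S.D

/-- The tolerance `ε₃ = (2 D_z B_f + 2 D_z B_f²) ε / D`. -/
def ε₃ : ℝ := (2 * S.Dz * S.Bf + 2 * S.Dz * S.Bf ^ 2) * S.ε / S.D

/-- The tolerance `ε₄ = ε² / D`. -/
def ε₄ : ℝ := S.ε ^ 2 / S.D

/-- The standing conditions on `x⁰, x̃_g, c, Δ₁`: `x⁰` lies in the level set `{g ≤ Γ}` and is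
`ε`-optimal for `f`; `x̃_g` is `ε`-optimal for `g`, and `f(x̃_g)` is finite; the regularity
condition `f_c(x⁰) < -Δ₁`; `c ≤ u₀`; and the two level sets of `g` are bounded. -/
structure Admissible (Γ : ℝ) : Prop where
  x0_lev : S.P.g S.x0 ≤ (Γ : EReal)
  x0_opt : S.P.f S.x0 ≤ S.P.fStar + (S.ε : EReal)
  xg_dom : S.P.f S.xg ≠ ⊤
  xg_opt : S.P.g S.xg ≤ S.P.gStar + (S.ε : EReal)
  regular : S.P.fc S.c S.x0 < ((-S.Δ₁ : ℝ) : EReal)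
  c_le : S.c ≤ S.u₀
  bdd₀ : Bornology.IsBounded (lev S.P.g S.D₀)
  bdd : Bornology.IsBounded (lev S.P.g S.DL)

/-- `out` is the result of the accelerated proximal gradient method, with accuracy `ε₁`, for
`φ₁ = g_ε + z f₁` and `φ₂ = g₂ + z f₂` started at `y₀`, where
`g_ε = g₁ + (ε / 2) ‖· - x⁰‖²` and `μ = ε`; it takes `N` oracle queries. (`0 * ⊤ = 0`, so
`φ₂ = g₂` for `z = 0`.) -/
def Call (z : ℝ) (y₀ out : Sp n) (N : ℕ) : Prop :=
  APG (fun x => S.P.g₁ x + S.ε / 2 * ‖x - S.x0‖ ^ 2 + z * S.P.f₁ x)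
    (fun x => S.P.g₂ x + (z : EReal) * S.P.f₂ x)
    S.Lmin S.ε S.γ₁ S.γ₂ y₀ S.ε₁ out N

/-- The test `[f_c(x)]₊ ≤ ε₂`. -/
def NearFeasible (x : Sp n) : Prop := max (S.P.fc S.c x) 0 ≤ (S.ε₂ : EReal)

/-- The test `|z f_c(x)| ≤ ε₃`. -/
def NearCompl (z : ℝ) (x : Sp n) : Prop :=
  ((-S.ε₃ : ℝ) : EReal) ≤ (z : EReal) * S.P.fc S.c x ∧
    (z : EReal) * S.P.fc S.c x ≤ (S.ε₃ : EReal)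

/-- The doubling loop of the interval search. `IntVLoop a b x a' b' x'`: from the interval
`[a, b]` and the point `x` computed for the multiplier `b`, the loop ends with `[a', b']`, `x'`. -/
inductive IntVLoop : ℝ → ℝ → Sp n → ℝ → ℝ → Sp n → Prop
  | exit {a b : ℝ} {x : Sp n} (h : ¬ (¬ S.NearFeasible x ∧ b ≤ S.Dz)) : IntVLoop a b x a b x
  | double {a b a' b' : ℝ} {x y x' : Sp n} {N : ℕ}
      (h : ¬ S.NearFeasible x ∧ b ≤ S.Dz)
      (hy : S.Call (2 * b) x y N)
      (hrec : IntVLoop b (2 * b) y a' b' x') : IntVLoop a b x a' b' x'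

/-- Interval search `IntV([0, σ], ε₁, ε₂, ε₃, y₀)`. `IntV σ y₀ a b xb`: it returns `Z = [a, b]`
(`Z = {b}` if `a = b`), and `xb` is the point that it has computed for the multiplier `b`. -/
inductive IntV (σ : ℝ) (y₀ : Sp n) : ℝ → ℝ → Sp n → Prop
  | zero {x : Sp n} {N : ℕ} (hx : S.Call 0 y₀ x N) (h : S.NearFeasible x) :
      IntV σ y₀ 0 0 x
  | point {x y xb : Sp n} {N M : ℕ} {a b : ℝ} (hx : S.Call 0 y₀ x N) (h : ¬ S.NearFeasible x)
      (hy : S.Call σ x y M) (hl : S.IntVLoop 0 σ y a b xb) (hc : S.NearCompl b xb) :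
      IntV σ y₀ b b xb
  | interval {x y xb : Sp n} {N M : ℕ} {a b : ℝ} (hx : S.Call 0 y₀ x N) (h : ¬ S.NearFeasible x)
      (hy : S.Call σ x y M) (hl : S.IntVLoop 0 σ y a b xb) (hc : ¬ S.NearCompl b xb) :
      IntV σ y₀ a b xb

/-- The bisection method for the dual problem. The state consists of the interval `[a, b]`, the
point `xb` computed for the multiplier `b`, and the latest point `x` (the next starting point).
`Bisec a b xb x out z N`: the loop started in this state returns `(out, z)` after `N` oracle
queries. Besides the queries of the inner method, every pass is charged two queries for the
evaluation of `f₁` and `f₂` in `f_c`. -/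
inductive Bisec : ℝ → ℝ → Sp n → Sp n → Sp n → ℝ → ℕ → Prop
  | done {a b : ℝ} {xb x : Sp n} (h : ¬ S.ε₄ < b - a) : Bisec a b xb x xb b 0
  | raise {a b z : ℝ} {xb x y out : Sp n} {M N : ℕ} (h : S.ε₄ < b - a)
      (hy : S.Call ((a + b) / 2) x y M) (hf : ¬ S.NearFeasible y)
      (hrec : Bisec ((a + b) / 2) b xb y out z N) :
      Bisec a b xb x out z (M + 2 + N)
  | hit {a b : ℝ} {xb x y : Sp n} {M : ℕ} (h : S.ε₄ < b - a)
      (hy : S.Call ((a + b) / 2) x y M) (hf : S.NearFeasible y)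
      (hc : S.NearCompl ((a + b) / 2) y) :
      Bisec a b xb x y ((a + b) / 2) (M + 2)
  | lower {a b z : ℝ} {xb x y out : Sp n} {M N : ℕ} (h : S.ε₄ < b - a)
      (hy : S.Call ((a + b) / 2) x y M) (hf : S.NearFeasible y)
      (hc : ¬ S.NearCompl ((a + b) / 2) y)
      (hrec : Bisec a ((a + b) / 2) y y out z N) :
      Bisec a b xb x out z (M + 2 + N)

end Setup

end SimpleBilevel

end

open SimpleBilevel

noncomputable section

namespace SimpleBilevel

variable {n : ℕ}

/-! ### Proper convex lower semicontinuous functions -/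

/-! The method searches for a Lagrange multiplier `z` of `min {g : f ≤ c}`, with `g` regularized by
`ε/2 ‖· - x⁰‖²` so that every penalized objective `g_ε + z f` is `ε`-strongly convex. The outer
argument uses only one property of an inner result: the near-optimality inequality `Near`, which
follows from the stopping test and strong convexity (`NearStationary.near_optimal`, `near_of_call`).

Inner method. The Lyapunov function "objective gap plus `μ/2` times the squared distance of an
auxiliary point to `u`" contracts by `1 - √(μ/L')` per iteration for every `u` of the domain
(`accelerated_step`). Taking for `u` the result of the extra proximal step bounds the gradient
mapping, hence a subgradient there (`nearStationary`). Accepted constants stay in `[Lmin, Lbar]`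
with `Lbar / Lmin` bounded, so each backtracking costs boundedly many queries, and a call costs
`O(√(Lbar/ε) |log ε|)` (`APGData.run`, `Regular.call`).

Search. As `x⁰` almost minimizes `f`, all inner results stay in one level set of `g`
(`near_mem_lev`), so warm starts are harmless. By the Slater condition at `x⁰`, every `z > D_z`
gives a feasible point (`nearFeasible_of_Dz_lt`), so doubling stops with `b ≤ 2 D_z`. The search
maintains a bracket: feasible at `b`, infeasible at `a` unless `a = 0` or complementarity has
already been tested. When the bracket is short, strong convexity makes the two points close, and the
Lipschitz bound on `f` turns infeasibility at `a` into approximate complementarity at `b`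
(`neg_mul_le_of_short`, `bracket_short`).

Optimality. Comparing with a solution `s` leaves the error `ε/2 (‖s - x⁰‖² - ‖x - x⁰‖²)`, whose
crude bound, a multiple of `ε`, need not fit into `ε`. The remedy has two stages: the crude bound
shows that `x` almost solves the problem; by compactness some solution `s` is then close to `x`
(`exists_solution_near`), and for this `s` the error is a small fraction of `ε` (`isEpsOptimal`). It
fits because two distinct minimizers of `g` at distance `d` force `D_g ≥ d`, so the complementarity
error is at most `ε / (1 + d)` and leaves a fixed fraction of `ε` unused.

Uniformity. The threshold for `ε` must not depend on `x⁰` and `x̃_g`; `exists_uniform` bounds all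
derived constants in advance. Then `search` multiplies `O(|log ε|)` bisection passes by the cost of
a call. -/

lemma nonneg_of_forall_mul_add_sq {s B : ℝ}
    (h : ∀ t : ℝ, 0 < t → t ≤ 1 → 0 ≤ t * s + t ^ 2 * B) : 0 ≤ s := by
  by_contra hs
  push Not at hs
  have hB : 0 < |B| + 1 := by positivity
  -- Chosen so that `t * |B| ≤ -s / 2`, which keeps `s + t * B` negative.
  set t := min 1 (-s / (2 * (|B| + 1))) with ht
  have ht0 : 0 < t := lt_min one_pos (by apply div_pos <;> linarith)
  have ht1 : t ≤ 1 := min_le_left _ _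
  have ht2 : t * (2 * (|B| + 1)) ≤ -s := by
    have := min_le_right 1 (-s / (2 * (|B| + 1)))
    rwa [← ht, le_div_iff₀ (by positivity)] at this
  have h1 := h t ht0 ht1
  have h2 : 0 ≤ s + t * B := by
    have : 0 ≤ t * (s + t * B) := by nlinarith
    exact nonneg_of_mul_nonneg_right this ht0
  nlinarith [le_abs_self B, abs_nonneg B]

namespace ProperConvexLsc

variable {ψ ψ' : Sp n → EReal}

lemma coe_toReal (hψ : ProperConvexLsc ψ) {x : Sp n} (hx : x ∈ edom ψ) :
    (((ψ x).toReal : ℝ) : EReal) = ψ x :=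
  EReal.coe_toReal hx (hψ.ne_bot x)

lemma mem_edom_of_le {x : Sp n} {r : ℝ} (h : ψ x ≤ (r : EReal)) : x ∈ edom ψ :=
  fun h' => by rw [h'] at h; exact absurd h (by simp)

lemma toReal_le (hψ : ProperConvexLsc ψ) {x : Sp n} {r : ℝ} (h : ψ x ≤ (r : EReal)) :
    (ψ x).toReal ≤ r := by
  rw [← hψ.coe_toReal (mem_edom_of_le h)] at h
  exact_mod_cast h

lemma le_of_toReal_le (hψ : ProperConvexLsc ψ) {x : Sp n} {r : ℝ} (hx : x ∈ edom ψ)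
    (h : (ψ x).toReal ≤ r) : ψ x ≤ (r : EReal) := by
  rw [← hψ.coe_toReal hx]
  exact_mod_cast h

lemma segment (hψ : ProperConvexLsc ψ) {x y : Sp n} (hx : x ∈ edom ψ) (hy : y ∈ edom ψ)
    {t : ℝ} (h0 : 0 ≤ t) (h1 : t ≤ 1) :
    x + t • (y - x) ∈ edom ψ ∧
      (ψ (x + t • (y - x))).toReal ≤ (1 - t) * (ψ x).toReal + t * (ψ y).toReal := by
  have key := hψ.convex (x := (x, (ψ x).toReal)) (y := (y, (ψ y).toReal))
    (hψ.coe_toReal hx).ge (hψ.coe_toReal hy).ge (a := 1 - t) (b := t) (by linarith) h0 (by ring)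
  simp only [Set.mem_ofPred_eq, Prod.smul_mk, Prod.mk_add_mk, smul_eq_mul] at key
  have he : (1 - t) • x + t • y = x + t • (y - x) := by
    rw [sub_smul, smul_sub, one_smul]; abel
  rw [he] at key
  exact ⟨mem_edom_of_le key, hψ.toReal_le key⟩

lemma of_segment (h1 : ∀ x, ψ x ≠ ⊥) (h2 : (edom ψ).Nonempty) (h4 : LowerSemicontinuous ψ)
    (h3 : ∀ x ∈ edom ψ, ∀ y ∈ edom ψ, ∀ t : ℝ, 0 ≤ t → t ≤ 1 →
      ψ (x + t • (y - x)) ≤ (((1 - t) * (ψ x).toReal + t * (ψ y).toReal : ℝ) : EReal)) :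
    ProperConvexLsc ψ := by
  refine ⟨h1, h2, ?_, h4⟩
  rintro ⟨x, r⟩ hx ⟨y, s⟩ hy a b ha hb hab
  simp only [Set.mem_ofPred_eq, Prod.smul_mk, Prod.mk_add_mk, smul_eq_mul] at *
  have hx' := mem_edom_of_le hx
  have hy' := mem_edom_of_le hy
  have he : a • x + b • y = x + b • (y - x) := by
    rw [show a = 1 - b by linarith, sub_smul, smul_sub, one_smul]; abel
  rw [he]
  refine (h3 x hx' y hy' b hb (by linarith)).trans ?_
  rw [← EReal.coe_toReal hx' (h1 x), EReal.coe_le_coe_iff] at hx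
  rw [← EReal.coe_toReal hy' (h1 y), EReal.coe_le_coe_iff] at hy
  rw [EReal.coe_le_coe_iff, show a = 1 - b by linarith]
  have : 0 ≤ 1 - b := by linarith
  gcongr

lemma coe_real {φ : Sp n → ℝ} (h1 : ConvexOn ℝ Set.univ φ) (h2 : Continuous φ) :
    ProperConvexLsc (fun x => (φ x : EReal)) := by
  refine of_segment (fun x => EReal.coe_ne_bot _) ⟨0, EReal.coe_ne_top _⟩
    (continuous_coe_real_ereal.comp h2).lowerSemicontinuous ?_
  intro x _ y _ t h0 ht
  simp only [EReal.toReal_coe]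
  rw [EReal.coe_le_coe_iff]
  have := h1.2 (Set.mem_univ x) (Set.mem_univ y) (sub_nonneg.2 ht) h0 (sub_add_cancel 1 t)
  have he : (1 - t) • x + t • y = x + t • (y - x) := by
    rw [sub_smul, smul_sub, one_smul]; abel
  rwa [he] at this

lemma edom_add (hψ : ProperConvexLsc ψ) (hψ' : ProperConvexLsc ψ') :
    edom (fun x => ψ x + ψ' x) = edom ψ ∩ edom ψ' := by
  ext x
  exact EReal.add_ne_top_iff_ne_top₂ (hψ.ne_bot x) (hψ'.ne_bot x)

lemma add (hψ : ProperConvexLsc ψ) (hψ' : ProperConvexLsc ψ')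
    (hne : (edom ψ ∩ edom ψ').Nonempty) : ProperConvexLsc (fun x => ψ x + ψ' x) := by
  refine of_segment (fun x => EReal.add_ne_bot_iff.2 ⟨hψ.ne_bot x, hψ'.ne_bot x⟩)
    (by rwa [edom_add hψ hψ']) ?_ ?_
  · exact hψ.lsc.add' hψ'.lsc fun x =>
      EReal.continuousAt_add (.inr (hψ'.ne_bot x)) (.inl (hψ.ne_bot x))
  · intro x hx y hy t h0 h1
    rw [edom_add hψ hψ'] at hx hy
    obtain ⟨a1, a2⟩ := hψ.segment hx.1 hy.1 h0 h1
    obtain ⟨b1, b2⟩ := hψ'.segment hx.2 hy.2 h0 h1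
    rw [← hψ.coe_toReal a1, ← hψ'.coe_toReal b1, ← EReal.coe_add, EReal.coe_le_coe_iff,
      EReal.toReal_add hx.1 (hψ.ne_bot x) hx.2 (hψ'.ne_bot x),
      EReal.toReal_add hy.1 (hψ.ne_bot y) hy.2 (hψ'.ne_bot y)]
    linarith

lemma edom_coe_mul (hψ : ProperConvexLsc ψ) {z : ℝ} (hz : 0 < z) :
    edom (fun x => (z : EReal) * ψ x) = edom ψ := by
  ext x
  refine not_congr ⟨fun h => ?_, fun h => ?_⟩
  · by_contra h'
    simp only at h
    rw [← EReal.coe_toReal h' (hψ.ne_bot x), ← EReal.coe_mul] at h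
    exact EReal.coe_ne_top _ h
  · simp only [h, EReal.coe_mul_top_of_pos hz]

lemma coe_mul (hψ : ProperConvexLsc ψ) {z : ℝ} (hz : 0 < z) :
    ProperConvexLsc (fun x => (z : EReal) * ψ x) := by
  refine of_segment (fun x => ?_) (by rw [edom_coe_mul hψ hz]; exact hψ.nonempty_dom) ?_ ?_
  · have := hψ.ne_bot x
    rw [EReal.mul_ne_bot]
    simp [this, hz.le]
  · have hc : Continuous fun r : EReal => (z : EReal) * r :=
      continuous_iff_continuousAt.2 fun r => EReal.Tendsto.const_mul Filter.tendsto_id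
        (.inl (EReal.coe_ne_bot z)) (.inl (EReal.coe_ne_top z))
    refine hc.comp_lowerSemicontinuous hψ.lsc fun a b hab => ?_
    exact mul_le_mul_of_nonneg_left hab (by exact_mod_cast hz.le)
  · intro x hx y hy t h0 h1
    rw [edom_coe_mul hψ hz] at hx hy
    obtain ⟨a1, a2⟩ := hψ.segment hx hy h0 h1
    rw [← hψ.coe_toReal a1, ← EReal.coe_mul, EReal.coe_le_coe_iff, EReal.toReal_mul,
      EReal.toReal_mul, EReal.toReal_coe]
    nlinarith

/-- First order condition for the minimum of a convex function plus a function with a quadratic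
upper bound. -/
lemma variational (hψ : ProperConvexLsc ψ) {x a : Sp n} (hx : x ∈ edom ψ) {q : Sp n → ℝ} {K : ℝ}
    (hmin : ∀ u ∈ edom ψ, (ψ x).toReal + q x ≤ (ψ u).toReal + q u)
    (hq : ∀ u, q u ≤ q x + inner ℝ a (u - x) + K * ‖u - x‖ ^ 2) :
    ∀ u ∈ edom ψ, (ψ x).toReal - inner ℝ a (u - x) ≤ (ψ u).toReal := by
  intro u hu
  suffices 0 ≤ (ψ u).toReal - (ψ x).toReal + inner ℝ a (u - x) by linarith
  refine nonneg_of_forall_mul_add_sq (B := K * ‖u - x‖ ^ 2) fun t h0 h1 => ?_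
  obtain ⟨a1, a2⟩ := hψ.segment hx hu h0.le h1
  have h2 := hmin _ a1
  have h3 := hq (x + t • (u - x))
  rw [add_sub_cancel_left, inner_smul_right, norm_smul, mul_pow, Real.norm_eq_abs, sq_abs] at h3
  nlinarith

/-- A proper convex lower semicontinuous function has an affine-in-norm lower bound. -/
lemma exists_linear_lower_bound (hψ : ProperConvexLsc ψ) :
    ∃ w ∈ edom ψ, ∃ b : ℝ, 0 ≤ b ∧ ∀ u ∈ edom ψ, (ψ w).toReal - b - b * ‖u - w‖ ≤ (ψ u).toReal := by
  obtain ⟨w, hw⟩ := hψ.nonempty_dom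
  obtain ⟨p, hpb, hp⟩ := LowerSemicontinuousOn.exists_isMinOn (s := Metric.closedBall w 1)
    ⟨w, by simp⟩ (isCompact_closedBall w 1) (hψ.lsc.lowerSemicontinuousOn _)
  have hpw : ψ p ≤ ψ w := hp (by simp : w ∈ Metric.closedBall w 1)
  have hpd : p ∈ edom ψ := fun h => hw (top_le_iff.1 (h ▸ hpw))
  have hpr : (ψ p).toReal ≤ (ψ w).toReal := EReal.toReal_le_toReal hpw (hψ.ne_bot _) hw
  refine ⟨w, hw, (ψ w).toReal - (ψ p).toReal, by linarith, fun u hu => ?_⟩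
  by_cases hr : ‖u - w‖ ≤ 1
  · have : ψ p ≤ ψ u := hp (by simpa [Metric.mem_closedBall, dist_eq_norm] using hr)
    have := EReal.toReal_le_toReal this (hψ.ne_bot _) hu
    nlinarith [norm_nonneg (u - w)]
  · push Not at hr
    have hr0 : 0 < ‖u - w‖ := by linarith
    -- The segment from `w` to `u` meets the unit sphere, where the minimum over the ball bounds `ψ`
    -- below; convexity carries this bound out to `u`, at a loss linear in the distance.
    obtain ⟨a1, a2⟩ := hψ.segment hw hu (t := ‖u - w‖⁻¹) (by positivity)
      (inv_le_one_of_one_le₀ hr.le)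
    have : ψ p ≤ ψ (w + ‖u - w‖⁻¹ • (u - w)) := hp (by
      simp [Metric.mem_closedBall, dist_eq_norm, norm_smul, hr0.ne'])
    have h2 := (EReal.toReal_le_toReal this (hψ.ne_bot _) a1).trans a2
    have h3 := mul_le_mul_of_nonneg_left h2 hr0.le
    have h4 : ‖u - w‖ * ((1 - ‖u - w‖⁻¹) * (ψ w).toReal + ‖u - w‖⁻¹ * (ψ u).toReal) =
        (‖u - w‖ - 1) * (ψ w).toReal + (ψ u).toReal := by
      field_simp
    nlinarith

/-- Proximal points exist. -/
lemma exists_isProx (hψ : ProperConvexLsc ψ) {t : ℝ} (ht : 0 < t) (y : Sp n) :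
    ∃ p, IsProx ψ t y p := by
  obtain ⟨w, hw, b, hb, hlow⟩ := hψ.exists_linear_lower_bound
  set F : Sp n → EReal := fun u => ψ u + ((‖u - y‖ ^ 2 / (2 * t) : ℝ) : EReal) with hF
  have hFlsc : LowerSemicontinuous F := by
    refine hψ.lsc.add' (Continuous.lowerSemicontinuous ?_) fun x =>
      EReal.continuousAt_add (.inr (EReal.coe_ne_bot _)) (.inl (hψ.ne_bot x))
    exact continuous_coe_real_ereal.comp (by fun_prop)
  -- outside a large ball around `w`, the objective is larger than at `w`
  set s := ‖w - y‖
  set R := 2 * s + 2 * t * b + 2 * t * b + 1 with hR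
  have hs : 0 ≤ s := norm_nonneg _
  have hR1 : 1 ≤ R := by rw [hR]; nlinarith [mul_nonneg ht.le hb]
  obtain ⟨p, hpb, hp⟩ := LowerSemicontinuousOn.exists_isMinOn (s := Metric.closedBall w R)
    ⟨w, by simp; linarith⟩ (isCompact_closedBall w R) (hFlsc.lowerSemicontinuousOn _)
  refine ⟨p, fun u => ?_⟩
  by_cases hu : u ∈ Metric.closedBall w R
  · exact hp hu
  · have hpw : F p ≤ F w := hp (by simp; linarith : w ∈ Metric.closedBall w R)
    refine le_trans hpw ?_
    by_cases hud : u ∈ edom ψ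
    · simp only [hF]
      rw [← hψ.coe_toReal hw, ← hψ.coe_toReal hud, ← EReal.coe_add, ← EReal.coe_add,
        EReal.coe_le_coe_iff]
      rw [Metric.mem_closedBall, dist_eq_norm, not_le] at hu
      have h1 := hlow u hud
      have h2 : ‖u - w‖ - s ≤ ‖u - y‖ := by
        have := norm_sub_le (u - y) (w - y)
        rw [sub_sub_sub_cancel_right] at this
        linarith
      set r := ‖u - w‖
      have h3 : (r - s) ^ 2 ≤ ‖u - y‖ ^ 2 := by
        apply pow_le_pow_left₀ _ h2
        nlinarith [mul_nonneg ht.le hb]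
      -- Quadratic growth beats the linear loss: beyond `R` one has `r - 2 * s ≥ 4 * t * b` and `r ≥
      -- 1`.
      have h4 : b + b * r ≤ ((r - s) ^ 2 - s ^ 2) / (2 * t) := by
        rw [le_div_iff₀ (by positivity)]
        have e : (r - s) ^ 2 - s ^ 2 = r * (r - 2 * s) := by ring
        have h5 : 2 * t * b + 2 * t * b ≤ r - 2 * s := by linarith
        have h6 : r * (2 * t * b + 2 * t * b) ≤ r * (r - 2 * s) :=
          mul_le_mul_of_nonneg_left h5 (by linarith)
        have h7 : 0 ≤ (r - 1) * (2 * t * b) :=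
          mul_nonneg (by linarith) (by positivity)
        rw [e]; nlinarith
      have h8 : ((r - s) ^ 2 - s ^ 2) / (2 * t) ≤ ‖u - y‖ ^ 2 / (2 * t) - s ^ 2 / (2 * t) := by
        rw [← sub_div]; gcongr
      linarith
    · have : ψ u = ⊤ := not_not.1 hud
      simp only [hF, this, EReal.top_add_coe, le_top]

end ProperConvexLsc

lemma IsProx.mem_edom {ψ : Sp n → EReal} (hψ : ProperConvexLsc ψ) {t : ℝ} {y p : Sp n}
    (h : IsProx ψ t y p) : p ∈ edom ψ := by
  intro hp
  obtain ⟨w, hw⟩ := hψ.nonempty_dom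
  have := h w
  rw [hp, EReal.top_add_coe, ← hψ.coe_toReal hw, ← EReal.coe_add, top_le_iff] at this
  exact EReal.coe_ne_top _ this

/-- The subgradient inequality at a proximal point. -/
lemma IsProx.subgradient {ψ : Sp n → EReal} (hψ : ProperConvexLsc ψ) {L : ℝ} (hL : 0 < L)
    {y p : Sp n} (h : IsProx ψ (1 / L) y p) {u : Sp n} (hu : u ∈ edom ψ) :
    (ψ p).toReal + L * inner ℝ (y - p) (u - p) ≤ (ψ u).toReal := by
  have hp := h.mem_edom hψ
  have := hψ.variational (q := fun u => L / 2 * ‖u - y‖ ^ 2) (a := L • (p - y)) (K := L / 2) hp ?_ ?_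
    u hu
  · rw [inner_smul_left, ← neg_sub y p, inner_neg_left] at this
    simp only [conj_trivial] at this
    linarith
  · intro u hu
    have := h u
    rw [← hψ.coe_toReal hp, ← hψ.coe_toReal hu, ← EReal.coe_add, ← EReal.coe_add,
      EReal.coe_le_coe_iff] at this
    have e : ∀ s : ℝ, s / (2 * (1 / L)) = L / 2 * s := fun s => by field_simp
    rwa [e, e] at this
  · intro u
    apply le_of_eq
    have : u - y = (p - y) + (u - p) := by abel
    rw [this, norm_add_sq_real, inner_smul_left]
    simp only [conj_trivial]
    ring

/-! ### Smooth convex functions -/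

/-- `φ` is differentiable, `μ`-strongly convex and has a `Λ`-Lipschitz gradient. -/
structure StronglyConvexSmooth (φ : Sp n → ℝ) (μ Λ : ℝ) : Prop where
  diff : Differentiable ℝ φ
  lower : ∀ x y, φ x + inner ℝ (gradient φ x) (y - x) + μ / 2 * ‖y - x‖ ^ 2 ≤ φ y
  upper : ∀ x y, φ y ≤ φ x + inner ℝ (gradient φ x) (y - x) + Λ / 2 * ‖y - x‖ ^ 2
  lip : ∀ x y, ‖gradient φ x - gradient φ y‖ ≤ Λ * ‖x - y‖

lemma hasDerivAt_line {φ : Sp n → ℝ} (hφ : Differentiable ℝ φ) (x d : Sp n) (t : ℝ) :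
    HasDerivAt (fun s : ℝ => φ (x + s • d)) (inner ℝ (gradient φ (x + t • d)) d) t := by
  have h1 : HasFDerivAt φ (fderiv ℝ φ (x + t • d)) (x + t • d) := (hφ _).hasFDerivAt
  have h2 : HasDerivAt (fun s : ℝ => x + s • d) d t := by
    simpa using ((hasDerivAt_id t).smul_const d).const_add x
  have := h1.comp_hasDerivAt t h2
  rwa [← inner_gradient_left] at this

/-- The descent lemma. -/
lemma le_of_gradient_lipschitz {φ : Sp n → ℝ} (hφ : Differentiable ℝ φ) {Λ : ℝ}
    (hlip : ∀ x y, ‖gradient φ x - gradient φ y‖ ≤ Λ * ‖x - y‖) (x y : Sp n) :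
    φ y ≤ φ x + inner ℝ (gradient φ x) (y - x) + Λ / 2 * ‖y - x‖ ^ 2 := by
  set d := y - x with hd
  set k : ℝ → ℝ := fun t => φ (x + t • d) - (t * inner ℝ (gradient φ x) d + Λ / 2 * ‖d‖ ^ 2 * t ^ 2)
    with hk
  have hderiv : ∀ t, HasDerivAt k (inner ℝ (gradient φ (x + t • d)) d -
      (1 * inner ℝ (gradient φ x) d + Λ / 2 * ‖d‖ ^ 2 * (2 * t))) t := fun t => by
    refine (hasDerivAt_line hφ x d t).sub (((hasDerivAt_id t).mul_const _).add ?_)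
    simpa using (hasDerivAt_pow 2 t).const_mul (Λ / 2 * ‖d‖ ^ 2)
  have hanti : AntitoneOn k (Set.Icc 0 1) := by
    refine antitoneOn_of_deriv_nonpos (convex_Icc 0 1)
      (fun t _ => (hderiv t).continuousAt.continuousWithinAt)
      (fun t _ => (hderiv t).differentiableAt.differentiableWithinAt) fun t ht => ?_
    rw [interior_Icc] at ht
    rw [(hderiv t).deriv]
    have h1 : inner ℝ (gradient φ (x + t • d) - gradient φ x) d ≤ Λ * (t * ‖d‖) * ‖d‖ := by
      refine (real_inner_le_norm _ _).trans (mul_le_mul_of_nonneg_right ?_ (norm_nonneg _))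
      have := hlip (x + t • d) x
      rwa [add_sub_cancel_left, norm_smul, Real.norm_of_nonneg ht.1.le] at this
    rw [inner_sub_left] at h1
    linarith
  have := hanti (by simp) (by simp) zero_le_one
  simp only [hk, one_smul, zero_smul, hd, add_sub_cancel, add_zero] at this
  simp only [hd]
  linarith

lemma gradient_inner_le_of_convexOn {φ : Sp n → ℝ} (hc : ConvexOn ℝ Set.univ φ) (hφ : Differentiable ℝ φ)
    (x y : Sp n) : φ x + inner ℝ (gradient φ x) (y - x) ≤ φ y := by
  have h1 : ConvexOn ℝ Set.univ (fun s : ℝ => φ (x + s • (y - x))) := by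
    refine ⟨convex_univ, fun a _ b _ s t hs ht hst => ?_⟩
    have := hc.2 (Set.mem_univ (x + a • (y - x))) (Set.mem_univ (x + b • (y - x))) hs ht hst
    convert this using 2
    have : s • x + t • x = x := by rw [← add_smul, hst, one_smul]
    simp only [smul_eq_mul, smul_add, add_smul, mul_smul]
    nth_rewrite 1 [← this]
    abel
  have h2 := h1.le_slope_of_hasDerivAt (Set.mem_univ 0) (Set.mem_univ 1) zero_lt_one
    (hasDerivAt_line hφ x (y - x) 0)
  rw [slope_def_field] at h2
  simp only [zero_smul, add_zero, one_smul, add_sub_cancel, sub_zero, div_one] at h2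
  linarith

namespace StronglyConvexSmooth

variable {φ φ' : Sp n → ℝ} {μ μ' Λ Λ' : ℝ}

lemma of_convexOn (hc : ConvexOn ℝ Set.univ φ) (hd : ContDiff ℝ 1 φ) {K : ℝ≥0}
    (hl : LipschitzWith K (gradient φ)) : StronglyConvexSmooth φ 0 K := by
  have h1 := hd.differentiable one_ne_zero
  have h2 : ∀ x y, ‖gradient φ x - gradient φ y‖ ≤ K * ‖x - y‖ := fun x y => by
    simpa [dist_eq_norm] using hl.dist_le_mul x y
  refine ⟨h1, fun x y => ?_, le_of_gradient_lipschitz h1 h2, h2⟩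
  simpa using gradient_inner_le_of_convexOn hc h1 x y

lemma hasGradientAt (h : StronglyConvexSmooth φ μ Λ) (x : Sp n) :
    HasGradientAt φ (gradient φ x) x := (h.diff x).hasGradientAt

lemma of_hasGradientAt {G : Sp n → Sp n} (hG : ∀ x, HasGradientAt φ (G x) x)
    (lower : ∀ x y, φ x + inner ℝ (G x) (y - x) + μ / 2 * ‖y - x‖ ^ 2 ≤ φ y)
    (upper : ∀ x y, φ y ≤ φ x + inner ℝ (G x) (y - x) + Λ / 2 * ‖y - x‖ ^ 2)
    (lip : ∀ x y, ‖G x - G y‖ ≤ Λ * ‖x - y‖) : StronglyConvexSmooth φ μ Λ := by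
  have : gradient φ = G := gradient_eq hG
  exact ⟨fun x => (hG x).differentiableAt, by rwa [this], by rwa [this], by rwa [this]⟩

lemma add (h : StronglyConvexSmooth φ μ Λ) (h' : StronglyConvexSmooth φ' μ' Λ') :
    StronglyConvexSmooth (fun x => φ x + φ' x) (μ + μ') (Λ + Λ') := by
  refine of_hasGradientAt (G := fun x => gradient φ x + gradient φ' x) (fun x => ?_)
    (fun x y => ?_) (fun x y => ?_) (fun x y => ?_)
  · have := ((h.hasGradientAt x).hasFDerivAt).add ((h'.hasGradientAt x).hasFDerivAt)
    rw [← map_add] at this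
    exact this
  · have h1 := h.lower x y
    have h2 := h'.lower x y
    rw [inner_add_left]; linarith
  · have h1 := h.upper x y
    have h2 := h'.upper x y
    rw [inner_add_left]; linarith
  · have h1 := h.lip x y
    have h2 := h'.lip x y
    calc _ = ‖(gradient φ x - gradient φ y) + (gradient φ' x - gradient φ' y)‖ := by congr 1; abel
      _ ≤ _ := norm_add_le _ _
      _ ≤ _ := by linarith

lemma const_mul (h : StronglyConvexSmooth φ μ Λ) {z : ℝ} (hz : 0 ≤ z) :
    StronglyConvexSmooth (fun x => z * φ x) (z * μ) (z * Λ) := by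
  refine of_hasGradientAt (G := fun x => z • gradient φ x) (fun x => ?_)
    (fun x y => ?_) (fun x y => ?_) (fun x y => ?_)
  · have := ((h.hasGradientAt x).hasFDerivAt).const_mul z
    rw [← map_smul] at this
    exact this
  · have := mul_le_mul_of_nonneg_left (h.lower x y) hz
    rw [inner_smul_left]; simp only [conj_trivial]; linarith
  · have := mul_le_mul_of_nonneg_left (h.upper x y) hz
    rw [inner_smul_left]; simp only [conj_trivial]; linarith
  · have := mul_le_mul_of_nonneg_left (h.lip x y) hz
    rw [← smul_sub, norm_smul, Real.norm_of_nonneg hz]; linarith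

lemma half_sq_dist (w : Sp n) {μ : ℝ} (hμ : 0 ≤ μ) :
    StronglyConvexSmooth (fun x => μ / 2 * ‖x - w‖ ^ 2) μ μ := by
  -- A quadratic equals its second-order expansion, so one identity gives both the lower and the
  -- upper bound.
  have e : ∀ x y : Sp n, μ / 2 * ‖y - w‖ ^ 2 =
      μ / 2 * ‖x - w‖ ^ 2 + inner ℝ (μ • (x - w)) (y - x) + μ / 2 * ‖y - x‖ ^ 2 := fun x y => by
    have : y - w = (x - w) + (y - x) := by abel
    rw [this, norm_add_sq_real, inner_smul_left]
    simp only [conj_trivial]; ring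
  refine of_hasGradientAt (G := fun x => μ • (x - w)) (fun x => ?_)
    (fun x y => (e x y).ge) (fun x y => (e x y).le) (fun x y => ?_)
  · rw [hasGradientAt_iff_hasFDerivAt]
    have h1 : HasFDerivAt (fun x : Sp n => x - w) (ContinuousLinearMap.id ℝ (Sp n)) x :=
      (hasFDerivAt_id x).sub_const w
    have h2 := (h1.norm_sq).const_mul (μ / 2)
    have h3 : InnerProductSpace.toDual ℝ (Sp n) (μ • (x - w)) = (μ / 2) • 2 •
        (innerSL ℝ) (x - w) ∘SL ContinuousLinearMap.id ℝ (Sp n) := by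
      ext v
      simp
      ring
    rw [h3]
    exact h2
  · rw [← smul_sub, norm_smul, Real.norm_of_nonneg hμ, sub_sub_sub_cancel_right]

lemma mono (h : StronglyConvexSmooth φ μ Λ) (hΛ : Λ ≤ Λ') : StronglyConvexSmooth φ μ Λ' :=
  ⟨h.diff, h.lower, fun x y => (h.upper x y).trans (by gcongr),
    fun x y => (h.lip x y).trans (by gcongr)⟩

end StronglyConvexSmooth

/-! ### Proximal gradient steps -/

section ProxStep

variable {φ₁ : Sp n → ℝ} {h : Sp n → EReal} {μ Λ : ℝ}

/-- The fundamental inequality of a proximal gradient step. -/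
lemma prox_step (hφ : StronglyConvexSmooth φ₁ μ Λ) (hh : ProperConvexLsc h) {L : ℝ} (hL : 0 < L)
    {x y : Sp n} (hx : IsProx h (1 / L) (y - (1 / L) • gradient φ₁ y) x) (hd : Descent φ₁ y x L)
    {u : Sp n} (hu : u ∈ edom h) :
    φ₁ x + (h x).toReal + L / 2 * ‖u - x‖ ^ 2 + μ / 2 * ‖u - y‖ ^ 2 ≤
      φ₁ u + (h u).toReal + L / 2 * ‖u - y‖ ^ 2 := by
  have h1 := hx.subgradient hh hL hu
  have h2 := hφ.lower y u
  unfold Descent at hd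
  have e1 : y - (1 / L) • gradient φ₁ y - x = (y - x) - (1 / L) • gradient φ₁ y := by abel
  rw [e1, inner_sub_left, inner_smul_left] at h1
  simp only [conj_trivial] at h1
  have e2 : L * (inner ℝ (y - x) (u - x) - 1 / L * inner ℝ (gradient φ₁ y) (u - x)) =
      L * inner ℝ (y - x) (u - x) - inner ℝ (gradient φ₁ y) (u - x) := by
    field_simp
  rw [e2] at h1
  have e3 : inner ℝ (gradient φ₁ y) (u - y) =
      inner ℝ (gradient φ₁ y) (u - x) + inner ℝ (gradient φ₁ y) (x - y) := by
    rw [← inner_add_right]; congr 1; abel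
  have e4 : ‖u - y‖ ^ 2 = ‖u - x‖ ^ 2 + ‖x - y‖ ^ 2 - 2 * inner ℝ (y - x) (u - x) := by
    have : u - y = (u - x) - (y - x) := by abel
    rw [this, norm_sub_sq_real, ← norm_neg (y - x), neg_sub, real_inner_comm]; ring
  have e5 : L / 2 * ‖u - y‖ ^ 2 = L / 2 * ‖u - x‖ ^ 2 + L / 2 * ‖x - y‖ ^ 2
      - L * inner ℝ (y - x) (u - x) := by rw [e4]; ring
  linarith

/-- One step of the accelerated method contracts the potential with respect to every point of the
domain. -/
lemma accelerated_step (hφ : StronglyConvexSmooth φ₁ μ Λ) (hh : ProperConvexLsc h) (hμ : 0 < μ)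
    {L : ℝ} (hL : μ ≤ L) {x xp x' : Sp n} {αp : ℝ} (hα : 0 < αp) (hx : x ∈ edom h)
    (hx' : IsProx h (1 / L)
      (extrapolate μ x xp αp L - (1 / L) • gradient φ₁ (extrapolate μ x xp αp L)) x')
    (hd : Descent φ₁ (extrapolate μ x xp αp L) x' L) {u : Sp n} (hu : u ∈ edom h) :
    φ₁ x' + (h x').toReal - (φ₁ u + (h u).toReal)
        + μ / 2 * ‖x + (1 / √(μ / L)) • (x' - x) - u‖ ^ 2 ≤
      (1 - √(μ / L)) * (φ₁ x + (h x).toReal - (φ₁ u + (h u).toReal)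
        + μ / 2 * ‖xp + (1 / αp) • (x - xp) - u‖ ^ 2) := by
  have hL0 : 0 < L := hμ.trans_le hL
  set y := extrapolate μ x xp αp L with hy
  set α := √(μ / L) with hαdef
  have hα0 : 0 < α := Real.sqrt_pos.2 (by positivity)
  have hα1 : α ≤ 1 := by
    rw [hαdef]
    exact Real.sqrt_le_one.2 ((div_le_one hL0).2 hL)
  have hα2 : L * α ^ 2 = μ := by
    rw [hαdef, Real.sq_sqrt (by positivity)]; field_simp
  -- The auxiliary point of the potential, which the method never computes. The extrapolation weight
  -- is exactly the one for which `x - y = α • (y - v)`.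
  set v := xp + (1 / αp) • (x - xp) with hv
  -- `y` is a convex combination of `x` and `v`
  have hyv : x = y + α • (y - v) := by
    rw [hy, hv, extrapolate, ← hαdef]
    have hxp : xp + (1 / αp) • (x - xp) = x + ((1 - αp) / αp) • (x - xp) := by
      rw [sub_div, div_self hα.ne', sub_smul, one_smul]; abel
    rw [hxp]
    set d := x - xp
    rw [add_sub_add_left_eq_sub, ← sub_smul, add_assoc, smul_smul, ← add_smul]
    have : α * (1 - αp) / (αp * (1 + α)) + α * (α * (1 - αp) / (αp * (1 + α)) - (1 - αp) / αp)
        = 0 := by field_simp; ring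
    rw [this, zero_smul, add_zero]
  -- The claim is the combination of the step inequality at `x` with weight `1 - α` and at `u` with
  -- weight `α`. The nonnegative multiples `C'` and `D'` of `‖b‖ ^ 2` are left over and dropped.
  have A := prox_step hφ hh hL0 hx' hd hx
  have B := prox_step hφ hh hL0 hx' hd hu
  -- norms in terms of inner products of `a = x' - y`, `b = y - v`, `c = u - y`
  set a := x' - y
  set b := y - v with hb
  set c := u - y with hc
  have n1 : x - x' = α • b - a := by rw [hyv]; simp only [a]; abel_nf
  have n2 : x - y = α • b := by rw [hyv]; abel_nf
  have n3 : u - x' = c - a := by simp only [a, c]; abel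
  have n4 : v - u = -(b + c) := by simp only [b, c]; abel
  have n5 : x + (1 / α) • (x' - x) - u = (1 / α) • (a - (α * (1 - α)) • b - α • c) := by
    have q1 : x' - x = a - α • b := by rw [← neg_sub, n1]; abel
    have q2 : x - u = α • b - c := by rw [← n2]; simp only [c]; abel
    have q3 : x + (1 / α) • (x' - x) - u = (x - u) + (1 / α) • (x' - x) := by abel
    rw [q3, q1, q2]
    clear_value a b c α
    clear * - hα0
    have r1 : 1 / α * (α * (1 - α)) = 1 - α := by field_simp
    have r2 : 1 / α * α = 1 := by field_simp
    simp only [smul_sub, smul_smul, r1, r2, sub_smul, one_smul]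
    abel
  have n6 : μ / 2 * ‖x + (1 / α) • (x' - x) - u‖ ^ 2 =
      L / 2 * ‖a - (α * (1 - α)) • b - α • c‖ ^ 2 := by
    rw [n5, norm_smul, mul_pow, Real.norm_eq_abs, sq_abs, ← hα2]
    field_simp
  rw [n1, n2] at A
  rw [n3] at B
  rw [n6, n4, norm_neg]
  clear_value a b c α
  clear n1 n2 n3 n4 n5 n6 hx hd hx' hyv
  have s0 : 0 ≤ 1 - α := by linarith
  have A' := mul_le_mul_of_nonneg_left A s0
  have B' := mul_le_mul_of_nonneg_left B hα0.le
  have C' : 0 ≤ (1 - α) * (α * (L * α ^ 2 / 2 * ‖b‖ ^ 2)) := by positivity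
  have D' : 0 ≤ (1 - α) * (L * α ^ 2 / 2 * (α ^ 2 * ‖b‖ ^ 2)) := by positivity
  rw [← hα2] at A' B' ⊢
  have m1 : ‖α • b - a‖ ^ 2 = α ^ 2 * ‖b‖ ^ 2 - 2 * α * inner ℝ a b + ‖a‖ ^ 2 := by
    rw [norm_sub_sq_real, norm_smul, mul_pow, Real.norm_eq_abs, sq_abs, inner_smul_left,
      real_inner_comm]
    simp only [conj_trivial]; ring
  have m2 : ‖α • b‖ ^ 2 = α ^ 2 * ‖b‖ ^ 2 := by
    rw [norm_smul, mul_pow, Real.norm_eq_abs, sq_abs]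
  have m3 : ‖c - a‖ ^ 2 = ‖c‖ ^ 2 - 2 * inner ℝ a c + ‖a‖ ^ 2 := by
    rw [norm_sub_sq_real, real_inner_comm]
  have m4 : ‖b + c‖ ^ 2 = ‖b‖ ^ 2 + 2 * inner ℝ b c + ‖c‖ ^ 2 := norm_add_sq_real _ _
  have m5 : ‖a - (α * (1 - α)) • b - α • c‖ ^ 2 =
      ‖a‖ ^ 2 + (α * (1 - α)) ^ 2 * ‖b‖ ^ 2 + α ^ 2 * ‖c‖ ^ 2 - 2 * (α * (1 - α)) * inner ℝ a b
        - 2 * α * inner ℝ a c + 2 * (α * (1 - α)) * α * inner ℝ b c := by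
    rw [norm_sub_sq_real, norm_sub_sq_real, inner_sub_left, inner_smul_right, inner_smul_right,
      inner_smul_right, inner_smul_left, norm_smul, norm_smul, mul_pow, mul_pow, Real.norm_eq_abs,
      Real.norm_eq_abs, sq_abs, sq_abs]
    simp only [conj_trivial]; ring
  rw [m1, m2] at A'
  rw [m3] at B'
  rw [m4, m5]
  linarith

end ProxStep

/-! ### Backtracking -/

section Backtracking

variable {φ₁ : Sp n → ℝ} {h : Sp n → EReal} {μ Λ γ : ℝ}

lemma Descent.of_le (hφ : StronglyConvexSmooth φ₁ μ Λ) {L : ℝ} (hL : Λ ≤ L) (y x : Sp n) :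
    Descent φ₁ y x L :=
  (hφ.upper y x).trans (by gcongr)

lemma Backtrack.accepted {y : ℝ → Sp n} {L L' : ℝ} {x : Sp n} {m : ℕ}
    (hb : Backtrack φ₁ h γ y L L' x m) :
    IsProx h (1 / L') (y L' - (1 / L') • gradient φ₁ (y L')) x ∧ Descent φ₁ (y L') x L' := by
  induction hb with
  | accept hx hd => exact ⟨hx, hd⟩
  | reject _ _ _ ih => exact ih

/-- The accepted constant is at most `γΛ`, or the initial one. -/
lemma Backtrack.const_bounds (hφ : StronglyConvexSmooth φ₁ μ Λ) (hγ : 1 < γ) {y : ℝ → Sp n}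
    {L L' : ℝ} {x : Sp n} {m : ℕ} (hb : Backtrack φ₁ h γ y L L' x m) (hL : 0 < L) :
    L ≤ L' ∧ L' ≤ max L (γ * Λ) ∧ L' * γ = L * γ ^ m := by
  induction hb with
  | accept hx hd => exact ⟨le_rfl, le_max_left _ _, by rw [pow_one]⟩
  | @reject L L' x x' m hx hd _ ih =>
    obtain ⟨h1, h2, h3⟩ := ih (by positivity)
    have hlt : L < Λ := by
      by_contra hle
      exact hd (Descent.of_le hφ (not_lt.1 hle) _ _)
    refine ⟨le_trans ?_ h1, h2.trans ?_, by rw [h3]; ring⟩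
    · nlinarith
    · exact max_le (le_max_of_le_right (by gcongr)) (le_max_right _ _)

/-- The `m`-th trial uses the constant `L * γ ^ (m - 1)`, so `m - 1` is the logarithm to base `γ` of
the total growth. -/
lemma Backtrack.count_le (hφ : StronglyConvexSmooth φ₁ μ Λ) (hγ : 1 < γ) {y : ℝ → Sp n}
    {L L' κ : ℝ} {x : Sp n} {m : ℕ} (hb : Backtrack φ₁ h γ y L L' x m) (hL : 0 < L)
    (hκ : L' ≤ κ * L) : (m : ℝ) ≤ 1 + Real.log κ / Real.log γ := by
  obtain ⟨h1, -, h3⟩ := hb.const_bounds hφ hγ hL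
  have hlog : 0 < Real.log γ := Real.log_pos hγ
  have hpow : γ ^ m ≤ κ * γ := by
    have : L * γ ^ m ≤ L * (κ * γ) := by
      rw [← h3]; nlinarith
    exact le_of_mul_le_mul_left this hL
  have hκ0 : 0 < κ := by
    by_contra hn
    have : κ * L ≤ 0 := mul_nonpos_of_nonpos_of_nonneg (not_lt.1 hn) hL.le
    linarith
  have h4 := Real.log_le_log (by positivity) hpow
  rw [Real.log_pow, Real.log_mul hκ0.ne' (by positivity)] at h4
  have h5 : ((m : ℝ) - 1) * Real.log γ ≤ Real.log κ := by linarith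
  have := (le_div_iff₀ hlog).2 h5
  linarith

/-- The acceptance test holds as soon as the trial constant reaches `Λ`, whatever the base point is.
-/
lemma Backtrack.exists (hφ : StronglyConvexSmooth φ₁ μ Λ) (hh : ProperConvexLsc h) (hγ : 1 < γ)
    (y : ℝ → Sp n) {L : ℝ} (hL : 0 < L) : ∃ L' x m, Backtrack φ₁ h γ y L L' x m := by
  obtain ⟨j, hj⟩ := pow_unbounded_of_one_lt (Λ / L) hγ
  rw [div_lt_iff₀ hL] at hj
  induction j generalizing L with
  | zero =>
    obtain ⟨x, hx⟩ := hh.exists_isProx (t := 1 / L) (by positivity)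
      (y L - (1 / L) • gradient φ₁ (y L))
    exact ⟨L, x, 1, .accept hx (Descent.of_le hφ (by simpa using hj.le) _ _)⟩
  | succ j ih =>
    obtain ⟨x, hx⟩ := hh.exists_isProx (t := 1 / L) (by positivity)
      (y L - (1 / L) • gradient φ₁ (y L))
    by_cases hd : Descent φ₁ (y L) x L
    · exact ⟨L, x, 1, .accept hx hd⟩
    · obtain ⟨L', x', m, hb⟩ := ih (L := γ * L) (by positivity) (by rw [pow_succ] at hj; linarith)
      exact ⟨L', x', m + 1, .reject hx hd hb⟩

end Backtracking

/-! ### Convergence of the accelerated proximal gradient method -/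

/-- Standing assumptions on the data of the accelerated proximal gradient method. All accepted
constants lie in `[Lmin, Lbar]`, and `lb` is a lower bound of the objective. -/
structure APGData (φ₁ : Sp n → ℝ) (h : Sp n → EReal) (γ₁ γ₂ Lmin μ Λ Lbar lb : ℝ) (w : Sp n) :
    Prop where
  smooth : StronglyConvexSmooth φ₁ μ Λ
  pcl : ProperConvexLsc h
  one_lt : 1 < γ₁
  one_le : 1 ≤ γ₂
  μ_pos : 0 < μ
  μ_le : μ ≤ Lmin
  Lmin_le : Lmin ≤ Lbar
  Λ_nonneg : 0 ≤ Λ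
  Λ_le : γ₁ * Λ ≤ Lbar
  low : ∀ x ∈ edom h, lb + μ / 2 * ‖x - w‖ ^ 2 ≤ φ₁ x + (h x).toReal

namespace APGData

variable {φ₁ : Sp n → ℝ} {h : Sp n → EReal} {γ₁ γ₂ Lmin μ Λ Lbar lb tol : ℝ} {w : Sp n}

/-- The invariant of the main loop, with the contraction factor `θ` reached so far. -/
structure Inv (φ₁ : Sp n → ℝ) (h : Sp n → EReal) (Lmin Lbar μ : ℝ) (x₀ : Sp n) (θ : ℝ)
    (x xp : Sp n) (L αp : ℝ) : Prop where
  mem : x ∈ edom h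
  α_pos : 0 < αp
  L_ge : Lmin ≤ L
  L_le : L ≤ Lbar
  θ_nonneg : 0 ≤ θ
  pot : ∀ u ∈ edom h, φ₁ x + (h x).toReal - (φ₁ u + (h u).toReal)
      + μ / 2 * ‖xp + (1 / αp) • (x - xp) - u‖ ^ 2 ≤
    θ * (φ₁ x₀ + (h x₀).toReal - (φ₁ u + (h u).toReal) + μ / 2 * ‖x₀ - u‖ ^ 2)

variable (H : APGData φ₁ h γ₁ γ₂ Lmin μ Λ Lbar lb w)
include H

lemma Lmin_pos : 0 < Lmin := H.μ_pos.trans_le H.μ_le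

lemma Λ_le' : Λ ≤ Lbar := by
  have := H.Λ_le
  nlinarith [H.one_lt, H.Λ_nonneg]

lemma backtrack_bounds {y : ℝ → Sp n} {L L' : ℝ} {x : Sp n} {m : ℕ}
    (hb : Backtrack φ₁ h γ₁ y L L' x m) (h1 : Lmin ≤ L) (h2 : L ≤ Lbar) :
    Lmin ≤ L' ∧ L' ≤ Lbar ∧ (m : ℝ) ≤ 1 + Real.log (Lbar / Lmin) / Real.log γ₁ := by
  have hL := H.Lmin_pos.trans_le h1
  obtain ⟨a1, a2, -⟩ := hb.const_bounds H.smooth H.one_lt hL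
  have a3 : L' ≤ Lbar := a2.trans (max_le h2 H.Λ_le)
  refine ⟨h1.trans a1, a3, hb.count_le H.smooth H.one_lt hL (a3.trans ?_)⟩
  have hp := H.Lmin_pos
  rw [div_mul_eq_mul_div, le_div_iff₀ hp]
  have : 0 < Lbar := hp.trans_le H.Lmin_le
  gcongr

/-- Contraction factors multiply along the run. Dividing by `γ₂ ≥ 1` cannot push the next trial
constant above `Lbar`, and the maximum keeps it above `Lmin`, so the value of `γ₂` does not enter
the bounds. -/
lemma inv_step {x₀ x xp xt : Sp n} {θ L αp Lt : ℝ} {m : ℕ}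
    (hI : Inv φ₁ h Lmin Lbar μ x₀ θ x xp L αp)
    (hb : Backtrack φ₁ h γ₁ (extrapolate μ x xp αp) L Lt xt m) :
    Inv φ₁ h Lmin Lbar μ x₀ ((1 - √(μ / Lt)) * θ) xt x (max Lmin (Lt / γ₂)) (√(μ / Lt)) := by
  obtain ⟨a1, a2, -⟩ := H.backtrack_bounds hb hI.L_ge hI.L_le
  have hLt : 0 < Lt := H.Lmin_pos.trans_le a1
  obtain ⟨b1, b2⟩ := hb.accepted
  have hμ := H.μ_pos
  have hle : √(μ / Lt) ≤ 1 := Real.sqrt_le_one.2 ((div_le_one hLt).2 (H.μ_le.trans a1))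
  refine ⟨b1.mem_edom H.pcl, Real.sqrt_pos.2 (by positivity), le_max_left _ _,
    max_le H.Lmin_le ((div_le_self hLt.le H.one_le).trans a2),
    mul_nonneg (by linarith) hI.θ_nonneg, fun u hu => ?_⟩
  refine (accelerated_step H.smooth H.pcl H.μ_pos (H.μ_le.trans a1) hI.α_pos hI.mem b1 b2 hu).trans
    ?_
  rw [mul_assoc]
  exact mul_le_mul_of_nonneg_left (hI.pot u hu) (by linarith)

/-- The gradient mapping gives a subgradient at the result of a proximal gradient step. -/
lemma subgradient_step {Lh : ℝ} (hLh : 0 < Lh) {xt xh : Sp n}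
    (hx : IsProx h (1 / Lh) (xt - (1 / Lh) • gradient φ₁ xt) xh) :
    Lh • (xt - xh) + gradient φ₁ xh - gradient φ₁ xt ∈
      subdiff (fun u => (φ₁ u : EReal) + h u) xh := by
  intro y
  by_cases hy : y ∈ edom h
  · have hxh := hx.mem_edom H.pcl
    have h1 := hx.subgradient H.pcl hLh hy
    have h2 := H.smooth.lower xh y
    simp only
    rw [← H.pcl.coe_toReal hy, ← H.pcl.coe_toReal hxh, ← EReal.coe_add, ← EReal.coe_add,
      ← EReal.coe_add, EReal.coe_le_coe_iff]
    have e1 : xt - (1 / Lh) • gradient φ₁ xt - xh = (xt - xh) - (1 / Lh) • gradient φ₁ xt := by abel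
    rw [e1, inner_sub_left, inner_smul_left] at h1
    simp only [conj_trivial] at h1
    have e2 : Lh * (inner ℝ (xt - xh) (y - xh) - 1 / Lh * inner ℝ (gradient φ₁ xt) (y - xh)) =
        Lh * inner ℝ (xt - xh) (y - xh) - inner ℝ (gradient φ₁ xt) (y - xh) := by
      field_simp
    rw [e2] at h1
    rw [inner_sub_left, inner_add_left, inner_smul_left]
    simp only [conj_trivial]
    have h3 : 0 ≤ μ / 2 * ‖y - xh‖ ^ 2 := by have := H.μ_pos; positivity
    linarith
  · have : h y = ⊤ := not_not.1 hy
    simp only [this, EReal.coe_add_top, le_top]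

/-- The stopping test succeeds once the contraction factor is small. -/
lemma nearStationary {x₀ x xp xh : Sp n} {θ L αp Lt Lh : ℝ} {m : ℕ} (hx₀ : x₀ ∈ edom h)
    (htol : 0 ≤ tol)
    (hI : Inv φ₁ h Lmin Lbar μ x₀ θ x xp L αp)
    (h1 : Lmin ≤ Lt) (h2 : Lt ≤ Lbar)
    (hb : Backtrack φ₁ h γ₁ (fun _ => x) Lt Lh xh m)
    (hθ : θ * (32 * (φ₁ x₀ + (h x₀).toReal - lb) * Lbar ^ 2 / Lmin) ≤ tol ^ 2) :
    NearStationary φ₁ h tol xh := by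
  obtain ⟨a1, a2, -⟩ := H.backtrack_bounds hb h1 h2
  have hμ := H.μ_pos
  have hm := H.Lmin_pos
  have hLh : 0 < Lh := hm.trans_le a1
  obtain ⟨b1, b2⟩ := hb.accepted
  have hxh := b1.mem_edom H.pcl
  set v := Lh • (x - xh) + gradient φ₁ xh - gradient φ₁ x with hv
  have hvmem := H.subgradient_step hLh b1
  -- function values decrease
  have c1 : φ₁ x + (h x).toReal ≤ φ₁ x₀ + (h x₀).toReal := by
    have := hI.pot x₀ hx₀
    rw [sub_self, sub_self, norm_zero] at this
    have h0 : 0 ≤ μ / 2 * ‖xp + (1 / αp) • (x - xp) - x₀‖ ^ 2 := by positivity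
    linarith
  have c2 := prox_step H.smooth H.pcl hLh b1 b2 hI.mem
  rw [sub_self, norm_zero] at c2
  -- The potential is used at the new point `xh` itself; this is why the invariant is kept for all
  -- `u`, and no minimizer is needed.
  have c3 := hI.pot xh hxh
  have c4 := H.low x₀ hx₀
  have c5 := H.low xh hxh
  have h0 : 0 ≤ μ / 2 * ‖xp + (1 / αp) • (x - xp) - xh‖ ^ 2 := by positivity
  set A := φ₁ x₀ + (h x₀).toReal - lb with hA
  have c6 : φ₁ xh + (h xh).toReal ≤ φ₁ x₀ + (h x₀).toReal := by
    have : 0 ≤ Lh / 2 * ‖x - xh‖ ^ 2 := by positivity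
    linarith
  -- The quadratic term in `low` bounds distances to `w` by gaps above `lb`, so the initial
  -- potential relative to `xh` is at most `4 * A`.
  have c7 : ‖x₀ - xh‖ ^ 2 ≤ 2 * ‖x₀ - w‖ ^ 2 + 2 * ‖xh - w‖ ^ 2 := by
    have e : x₀ - xh = (x₀ - w) - (xh - w) := by abel
    have := parallelogram_law_with_norm ℝ (x₀ - w) (xh - w)
    rw [e]
    nlinarith [sq_nonneg ‖x₀ - w + (xh - w)‖]
  have c8 : μ / 2 * ‖x₀ - xh‖ ^ 2 ≤ μ / 2 * (2 * ‖x₀ - w‖ ^ 2 + 2 * ‖xh - w‖ ^ 2) := by gcongr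
  have c9 : φ₁ x₀ + (h x₀).toReal - (φ₁ xh + (h xh).toReal) + μ / 2 * ‖x₀ - xh‖ ^ 2 ≤ 4 * A := by
    linarith
  have c10 : Lh / 2 * ‖x - xh‖ ^ 2 ≤ θ * (4 * A) := by
    have := mul_le_mul_of_nonneg_left c9 hI.θ_nonneg
    linarith
  have d1 : ‖v‖ ≤ 2 * Lbar * ‖x - xh‖ := by
    have e : v = Lh • (x - xh) + (gradient φ₁ xh - gradient φ₁ x) := by rw [hv]; abel
    have l1 := H.smooth.lip xh x
    rw [norm_sub_rev xh x] at l1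
    calc ‖v‖ ≤ ‖Lh • (x - xh)‖ + ‖gradient φ₁ xh - gradient φ₁ x‖ := by rw [e]; exact norm_add_le _ _
      _ ≤ Lh * ‖x - xh‖ + Λ * ‖x - xh‖ := by
          rw [norm_smul, Real.norm_of_nonneg hLh.le]; linarith
      _ ≤ Lbar * ‖x - xh‖ + Lbar * ‖x - xh‖ := by
          have := H.Λ_le'
          gcongr
      _ = _ := by ring
  have d2 : ‖v‖ ^ 2 ≤ tol ^ 2 := by
    calc ‖v‖ ^ 2 ≤ (2 * Lbar * ‖x - xh‖) ^ 2 := by gcongr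
      _ = 8 * Lbar ^ 2 / Lmin * (Lmin / 2 * ‖x - xh‖ ^ 2) := by field_simp; ring
      _ ≤ 8 * Lbar ^ 2 / Lmin * (Lh / 2 * ‖x - xh‖ ^ 2) := by gcongr
      _ ≤ 8 * Lbar ^ 2 / Lmin * (θ * (4 * A)) := by gcongr
      _ = θ * (32 * A * Lbar ^ 2 / Lmin) := by ring
      _ ≤ _ := hθ
  have d3 : ‖v‖ ≤ tol := abs_le_of_sq_le_sq' d2 htol |>.2
  refine (Metric.infEDist_le_edist_of_mem hvmem).trans ?_
  rw [edist_dist, dist_zero_left]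
  exact ENNReal.ofReal_le_ofReal d3

/-- Existence of a run of the main loop and a bound for the cost of every run. -/
lemma loop {x₀ : Sp n} (hx₀ : x₀ ∈ edom h) (htol : 0 ≤ tol) (j : ℕ) {θ L αp : ℝ} {x xp : Sp n}
    (hI : Inv φ₁ h Lmin Lbar μ x₀ θ x xp L αp)
    (hθ : θ * (1 - √(μ / Lbar)) ^ (j + 1) * (32 * (φ₁ x₀ + (h x₀).toReal - lb) * Lbar ^ 2 / Lmin)
      ≤ tol ^ 2) :
    (∃ out N, APGLoop φ₁ h γ₁ γ₂ Lmin μ tol x xp L αp out N) ∧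
    ∀ out N, APGLoop φ₁ h γ₁ γ₂ Lmin μ tol x xp L αp out N →
      (N : ℝ) ≤ (j + 1) * (8 * (1 + Real.log (Lbar / Lmin) / Real.log γ₁) + 1) := by
  set M := 1 + Real.log (Lbar / Lmin) / Real.log γ₁ with hM
  set B := 32 * (φ₁ x₀ + (h x₀).toReal - lb) * Lbar ^ 2 / Lmin with hB
  have hm := H.Lmin_pos
  have hμ := H.μ_pos
  have hLbar : 0 < Lbar := hm.trans_le H.Lmin_le
  have hB0 : 0 ≤ B := by
    have : 0 ≤ φ₁ x₀ + (h x₀).toReal - lb := by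
      have := H.low x₀ hx₀
      have h0 : 0 ≤ μ / 2 * ‖x₀ - w‖ ^ 2 := by positivity
      linarith
    positivity
  have hM0 : 0 ≤ M := by
    have : 0 ≤ Real.log (Lbar / Lmin) := Real.log_nonneg ((one_le_div hm).2 H.Lmin_le)
    have := Real.log_pos H.one_lt
    positivity
  have hq : ∀ {Lt : ℝ}, Lmin ≤ Lt → Lt ≤ Lbar → (1 - √(μ / Lt)) ≤ 1 - √(μ / Lbar) := by
    intro Lt h1 h2
    have : 0 < Lt := hm.trans_le h1
    have : √(μ / Lbar) ≤ √(μ / Lt) := Real.sqrt_le_sqrt (by gcongr)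
    linarith
  have hq0 : 0 ≤ 1 - √(μ / Lbar) := by
    have := Real.sqrt_le_one.2 ((div_le_one hLbar).2 (H.μ_le.trans H.Lmin_le))
    linarith
  have cost : ∀ {Lt Lh : ℝ} {xt xh : Sp n} {m m' : ℕ} {x xp : Sp n} {L αp θ : ℝ},
      Inv φ₁ h Lmin Lbar μ x₀ θ x xp L αp →
      Backtrack φ₁ h γ₁ (extrapolate μ x xp αp) L Lt xt m →
      Backtrack φ₁ h γ₁ (fun _ => xt) Lt Lh xh m' →
      ((4 * m + 4 * m' + 1 : ℕ) : ℝ) ≤ 8 * M + 1 := by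
    intro Lt Lh xt xh m m' x xp L αp θ hI h1 h2
    obtain ⟨a1, a2, a3⟩ := H.backtrack_bounds h1 hI.L_ge hI.L_le
    obtain ⟨-, -, b3⟩ := H.backtrack_bounds h2 a1 a2
    push_cast
    linarith
  induction j generalizing θ L αp x xp with
  | zero =>
    -- An accelerated step precedes each test, so the exponent `j + 1` still supplies one
    -- contraction when `j = 0`.
    have near : ∀ {Lt Lh : ℝ} {xt xh : Sp n} {m m' : ℕ},
        Backtrack φ₁ h γ₁ (extrapolate μ x xp αp) L Lt xt m →
        Backtrack φ₁ h γ₁ (fun _ => xt) Lt Lh xh m' → NearStationary φ₁ h tol xh := by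
      intro Lt Lh xt xh m m' h1 h2
      obtain ⟨a1, a2, -⟩ := H.backtrack_bounds h1 hI.L_ge hI.L_le
      refine H.nearStationary hx₀ htol (H.inv_step hI h1) a1 a2 h2 (le_trans ?_ hθ)
      rw [zero_add, pow_one, mul_comm θ]
      have := hI.θ_nonneg
      have := hq a1 a2
      gcongr
    constructor
    · obtain ⟨Lt, xt, m, h1⟩ := Backtrack.exists H.smooth H.pcl H.one_lt (extrapolate μ x xp αp)
        (hm.trans_le hI.L_ge)
      obtain ⟨a1, a2, -⟩ := H.backtrack_bounds h1 hI.L_ge hI.L_le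
      obtain ⟨Lh, xh, m', h2⟩ := Backtrack.exists H.smooth H.pcl H.one_lt (fun _ => xt)
        (hm.trans_le a1)
      exact ⟨_, _, .halt h1 h2 (near h1 h2)⟩
    · intro out N hr
      cases hr with
      | halt h1 h2 ht => simpa using cost hI h1 h2
      | next h1 h2 ht hrec => exact absurd (near h1 h2) ht
  | succ j ih =>
    have small : ∀ {Lt : ℝ} {xt : Sp n} {m : ℕ},
        Backtrack φ₁ h γ₁ (extrapolate μ x xp αp) L Lt xt m →
        (1 - √(μ / Lt)) * θ * (1 - √(μ / Lbar)) ^ (j + 1) * B ≤ tol ^ 2 := by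
      intro Lt xt m h1
      obtain ⟨a1, a2, -⟩ := H.backtrack_bounds h1 hI.L_ge hI.L_le
      refine le_trans ?_ hθ
      rw [pow_succ _ (j + 1), mul_comm (1 - √(μ / Lt)), mul_assoc θ, mul_comm (1 - √(μ / Lt))]
      have := hI.θ_nonneg
      have := hq a1 a2
      gcongr
    constructor
    · obtain ⟨Lt, xt, m, h1⟩ := Backtrack.exists H.smooth H.pcl H.one_lt (extrapolate μ x xp αp)
        (hm.trans_le hI.L_ge)
      obtain ⟨a1, a2, -⟩ := H.backtrack_bounds h1 hI.L_ge hI.L_le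
      obtain ⟨Lh, xh, m', h2⟩ := Backtrack.exists H.smooth H.pcl H.one_lt (fun _ => xt)
        (hm.trans_le a1)
      by_cases ht : NearStationary φ₁ h tol xh
      · exact ⟨_, _, .halt h1 h2 ht⟩
      · obtain ⟨out, N, hr⟩ := (ih (H.inv_step hI h1) (small h1)).1
        exact ⟨_, _, .next h1 h2 ht hr⟩
    · intro out N hr
      cases hr with
      | halt h1 h2 ht =>
        have := cost hI h1 h2
        have hj : (0 : ℝ) ≤ j := Nat.cast_nonneg j
        have : 0 ≤ ((j : ℝ) + 1) * (8 * M + 1) := by positivity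
        push_cast at *
        linarith
      | next h1 h2 ht hrec =>
        have c1 := cost hI h1 h2
        have c2 := (ih (H.inv_step hI h1) (small h1)).2 _ _ hrec
        push_cast at *
        linarith

/-- Existence of a run of the method and a bound for the cost of every run. -/
theorem run {y₀ u : Sp n} (hu : u ∈ edom h) (htol : 0 ≤ tol) (j : ℕ)
    (hj : (1 - √(μ / Lbar)) ^ (j + 1) *
      (32 * (φ₁ u + (h u).toReal - lb + Lbar / 2 * ‖u - y₀‖ ^ 2) * Lbar ^ 2 / Lmin) ≤ tol ^ 2) :
    (∃ out N, APG φ₁ h Lmin μ γ₁ γ₂ y₀ tol out N) ∧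
    ∀ out N, APG φ₁ h Lmin μ γ₁ γ₂ y₀ tol out N →
      (N : ℝ) ≤ (j + 2) * (8 * (1 + Real.log (Lbar / Lmin) / Real.log γ₁) + 1) := by
  have hm := H.Lmin_pos
  have hμ := H.μ_pos
  have hLbar : 0 < Lbar := hm.trans_le H.Lmin_le
  have start : ∀ {L : ℝ} {x₀ : Sp n} {m : ℕ}, Backtrack φ₁ h γ₁ (fun _ => y₀) Lmin L x₀ m →
      x₀ ∈ edom h ∧ Inv φ₁ h Lmin Lbar μ x₀ 1 x₀ x₀ (max Lmin (L / γ₂)) 1 ∧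
      1 * (1 - √(μ / Lbar)) ^ (j + 1) * (32 * (φ₁ x₀ + (h x₀).toReal - lb) * Lbar ^ 2 / Lmin)
      ≤ tol ^ 2 := by
    intro L x₀ m h1
    obtain ⟨a1, a2, -⟩ := H.backtrack_bounds h1 le_rfl H.Lmin_le
    have hL : 0 < L := hm.trans_le a1
    obtain ⟨b1, b2⟩ := h1.accepted
    refine ⟨b1.mem_edom H.pcl, ⟨b1.mem_edom H.pcl, one_pos, le_max_left _ _,
      max_le H.Lmin_le ((div_le_self hL.le H.one_le).trans a2), zero_le_one, fun u hu => ?_⟩, ?_⟩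
    · simp
    · refine le_trans ?_ hj
      -- The initial proximal step brings the objective below its value at any `u` plus `Lbar / 2 *
      -- ‖u - y₀‖ ^ 2`; the start `y₀` itself may lie outside the domain.
      have c1 := prox_step H.smooth H.pcl hL b1 b2 hu
      have c2 : 0 ≤ L / 2 * ‖u - x₀‖ ^ 2 := by positivity
      have c3 : 0 ≤ μ / 2 * ‖u - y₀‖ ^ 2 := by positivity
      have c4 : L / 2 * ‖u - y₀‖ ^ 2 ≤ Lbar / 2 * ‖u - y₀‖ ^ 2 := by gcongr
      have hq0 : 0 ≤ 1 - √(μ / Lbar) := by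
        have := Real.sqrt_le_one.2 ((div_le_one hLbar).2 (H.μ_le.trans H.Lmin_le))
        linarith
      rw [one_mul]
      gcongr
      linarith
  constructor
  · obtain ⟨L, x₀, m, h1⟩ := Backtrack.exists H.smooth H.pcl H.one_lt (fun _ => y₀) hm
    obtain ⟨s1, s2, s3⟩ := start h1
    obtain ⟨out, N, hr⟩ := (H.loop s1 htol j s2 s3).1
    exact ⟨out, _, L, x₀, m, N, h1, hr, rfl⟩
  · rintro out N ⟨L, x₀, m, M, h1, hr, rfl⟩
    obtain ⟨s1, s2, s3⟩ := start h1
    have c1 := (H.loop s1 htol j s2 s3).2 _ _ hr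
    obtain ⟨-, -, c2⟩ := H.backtrack_bounds h1 le_rfl H.Lmin_le
    have c3 : (0 : ℝ) ≤ m := Nat.cast_nonneg m
    push_cast
    linarith

end APGData

/-! ### Nearly stationary points -/

/-- A nearly stationary point of a strongly convex composite function is nearly optimal. -/
lemma NearStationary.near_optimal {φ₁ : Sp n → ℝ} {h : Sp n → EReal} {μ Λ tol : ℝ}
    (hφ : StronglyConvexSmooth φ₁ μ Λ) (hh : ProperConvexLsc h) (htol : 0 ≤ tol) {x : Sp n}
    (hx : NearStationary φ₁ h tol x) :
    x ∈ edom h ∧ ∀ u ∈ edom h, φ₁ x + (h x).toReal + μ / 2 * ‖u - x‖ ^ 2 ≤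
      φ₁ u + (h u).toReal + tol * ‖u - x‖ := by
  -- A slack `δ` avoids having to show that the distance to the subdifferential is attained; it also
  -- shows that the subdifferential is nonempty.
  have approx : ∀ δ : ℝ, 0 < δ → ∃ v ∈ subdiff (fun u => (φ₁ u : EReal) + h u) x, ‖v‖ ≤ tol + δ := by
    intro δ hδ
    have : Metric.infEDist 0 (subdiff (fun u => (φ₁ u : EReal) + h u) x) <
        ENNReal.ofReal (tol + δ) :=
      lt_of_le_of_lt hx ((ENNReal.ofReal_lt_ofReal_iff (by linarith)).2 (by linarith))
    obtain ⟨v, hv, hv'⟩ := Metric.infEDist_lt_iff.1 this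
    rw [edist_dist, dist_zero_left] at hv'
    exact ⟨v, hv, ((ENNReal.ofReal_lt_ofReal_iff (by linarith)).1 hv').le⟩
  have hmem : x ∈ edom h := by
    obtain ⟨v, hv, -⟩ := approx 1 one_pos
    obtain ⟨u, hu⟩ := hh.nonempty_dom
    intro htop
    have := hv u
    simp only at this
    rw [htop, EReal.coe_add_top, EReal.top_add_coe, ← hh.coe_toReal hu, ← EReal.coe_add,
      top_le_iff] at this
    exact EReal.coe_ne_top _ this
  refine ⟨hmem, fun u hu => ?_⟩
  refine le_of_forall_pos_le_add fun η hη => ?_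
  obtain ⟨v, hv, hvn⟩ := approx (η / (‖u - x‖ + 1)) (by positivity)
  have hsub : ∀ y ∈ edom h, φ₁ x + (h x).toReal + inner ℝ v (y - x) ≤ φ₁ y + (h y).toReal := by
    intro y hy
    have := hv y
    simp only at this
    rwa [← hh.coe_toReal hy, ← hh.coe_toReal hmem, ← EReal.coe_add, ← EReal.coe_add,
      ← EReal.coe_add, EReal.coe_le_coe_iff] at this
  -- The subgradient inequality of the sum has no quadratic term. Passing to a subgradient of `h`
  -- alone allows `φ₁` to be expanded again with its strong convexity.
  have h1 := hh.variational (x := x) (a := gradient φ₁ x - v) (q := fun y => φ₁ y - inner ℝ v (y - x))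
    (K := Λ / 2) hmem (fun y hy => by
      have := hsub y hy
      simp only [sub_self, inner_zero_right]
      linarith) (fun y => by
      have := hφ.upper x y
      simp only [sub_self, inner_zero_right, inner_sub_left]
      linarith) u hu
  rw [inner_sub_left] at h1
  have h2 := hφ.lower x u
  have h3 : -(‖v‖ * ‖u - x‖) ≤ inner ℝ v (u - x) := (abs_le.1 (abs_real_inner_le_norm _ _)).1
  have h4 : ‖v‖ * ‖u - x‖ ≤ (tol + η / (‖u - x‖ + 1)) * ‖u - x‖ := by gcongr
  have h5 : η / (‖u - x‖ + 1) * ‖u - x‖ ≤ η := by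
    rw [div_mul_eq_mul_div, div_le_iff₀ (by positivity)]
    nlinarith [norm_nonneg (u - x)]
  linarith

lemma APGLoop.nearStationary {φ₁ : Sp n → ℝ} {h : Sp n → EReal} {γ₁ γ₂ Lmin μ tol L αp : ℝ}
    {x xp out : Sp n} {N : ℕ} (hl : APGLoop φ₁ h γ₁ γ₂ Lmin μ tol x xp L αp out N) :
    NearStationary φ₁ h tol out := by
  induction hl with
  | halt _ _ ht => exact ht
  | next _ _ _ _ ih => exact ih

lemma APG.nearStationary {φ₁ : Sp n → ℝ} {h : Sp n → EReal} {Lmin μ γ₁ γ₂ tol : ℝ} {y out : Sp n}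
    {N : ℕ} (hr : APG φ₁ h Lmin μ γ₁ γ₂ y tol out N) : NearStationary φ₁ h tol out := by
  obtain ⟨L, x₀, m, M, -, hl, -⟩ := hr
  exact hl.nearStationary

/-! ### The simple bilevel problem -/

lemma lev_mono (ψ : Sp n → EReal) {r r' : ℝ} (h : r ≤ r') : lev ψ r ⊆ lev ψ r' :=
  fun _ hy => le_trans (α := EReal) hy (EReal.coe_le_coe_iff.2 h)

namespace Problem

variable {P : Problem n}

namespace Basic

variable (hP : P.Basic)
include hP

lemma f_pcl : ProperConvexLsc P.f := by
  have h1 := ProperConvexLsc.coe_real hP.f₁_convex hP.f₁_contDiff.continuous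
  refine h1.add hP.f₂_pcl ?_
  obtain ⟨x, hx⟩ := hP.f₂_pcl.nonempty_dom
  exact ⟨x, EReal.coe_ne_top _, hx⟩

lemma g_pcl : ProperConvexLsc P.g := by
  have h1 := ProperConvexLsc.coe_real hP.g₁_convex hP.g₁_contDiff.continuous
  refine h1.add hP.g₂_pcl ?_
  obtain ⟨x, hx⟩ := hP.g₂_pcl.nonempty_dom
  exact ⟨x, EReal.coe_ne_top _, hx⟩

lemma mem_edom_f {x : Sp n} : x ∈ edom P.f ↔ x ∈ edom P.f₂ := by
  refine (EReal.add_ne_top_iff_ne_top₂ (EReal.coe_ne_bot _) (hP.f₂_pcl.ne_bot x)).trans ?_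
  exact and_iff_right (EReal.coe_ne_top _)

lemma mem_edom_g {x : Sp n} : x ∈ edom P.g ↔ x ∈ edom P.g₂ := by
  refine (EReal.add_ne_top_iff_ne_top₂ (EReal.coe_ne_bot _) (hP.g₂_pcl.ne_bot x)).trans ?_
  exact and_iff_right (EReal.coe_ne_top _)

lemma toReal_f {x : Sp n} (hx : x ∈ edom P.f) : (P.f x).toReal = P.f₁ x + (P.f₂ x).toReal := by
  rw [f, EReal.toReal_add (EReal.coe_ne_top _) (EReal.coe_ne_bot _) (hP.mem_edom_f.1 hx)
    (hP.f₂_pcl.ne_bot x), EReal.toReal_coe]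

lemma toReal_g {x : Sp n} (hx : x ∈ edom P.g) : (P.g x).toReal = P.g₁ x + (P.g₂ x).toReal := by
  rw [g, EReal.toReal_add (EReal.coe_ne_top _) (EReal.coe_ne_bot _) (hP.mem_edom_g.1 hx)
    (hP.g₂_pcl.ne_bot x), EReal.toReal_coe]

lemma coe_fStar (hX : P.X.Nonempty) : ((P.fStar.toReal : ℝ) : EReal) = P.fStar := by
  refine EReal.coe_toReal ?_ hP.fStar_ne_bot
  obtain ⟨x, hx⟩ := hX
  exact ne_top_of_le_ne_top hx.1 (iInf₂_le x hx)

lemma coe_gStar (hX : P.X.Nonempty) : ((P.gStar.toReal : ℝ) : EReal) = P.gStar := by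
  refine EReal.coe_toReal ?_ hP.gStar_ne_bot
  obtain ⟨x, hx⟩ := hX
  exact ne_top_of_le_ne_top hx.2 (iInf₂_le x hx)

lemma fStar_le {x : Sp n} (hx : x ∈ P.X) : P.fStar.toReal ≤ (P.f x).toReal :=
  EReal.toReal_le_toReal (iInf₂_le x hx) hP.fStar_ne_bot hx.1

lemma gStar_le {x : Sp n} (hx : x ∈ P.X) : P.gStar.toReal ≤ (P.g x).toReal :=
  EReal.toReal_le_toReal (iInf₂_le x hx) hP.gStar_ne_bot hx.2

lemma isClosed_lev_g (r : ℝ) : IsClosed (lev P.g r) := hP.g_pcl.lsc.isClosed_preimage _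

lemma solG_edom {p : Sp n} (hp : p ∈ P.solG) : p ∈ edom P.g := by
  obtain ⟨x, hx⟩ := hP.g_pcl.nonempty_dom
  exact ne_top_of_le_ne_top hx (hp x)

lemma solG_le {p x : Sp n} (hp : p ∈ P.solG) (hx : x ∈ edom P.g) :
    (P.g p).toReal ≤ (P.g x).toReal :=
  EReal.toReal_le_toReal (hp x) (hP.g_pcl.ne_bot p) hx

/-- If a level set of `g` above the minimal value is bounded, then all level sets are. -/
lemma isBounded_lev {p : Sp n} (hp : p ∈ P.solG) {r₀ : ℝ} (hr₀ : (P.g p).toReal < r₀)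
    (hb : Bornology.IsBounded (lev P.g r₀)) (r : ℝ) : Bornology.IsBounded (lev P.g r) := by
  obtain ⟨R, hR0, hR⟩ := hb.subset_closedBall_lt 0 p
  set m := (P.g p).toReal
  refine (Metric.isBounded_closedBall (x := p) (r := max (R + 1)
    ((R + 1) * (r - m) / (r₀ - m)))).subset fun x hx => ?_
  rw [Metric.mem_closedBall, dist_eq_norm, le_max_iff]
  by_cases ht : ‖x - p‖ ≤ R + 1
  · exact Or.inl ht
  · right
    push Not at ht
    have hx' := ProperConvexLsc.mem_edom_of_le hx
    have ht0 : 0 < ‖x - p‖ := by linarith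
    -- The point at this fraction of the segment has distance `R + 1` from `p`, outside the level
    -- set of `r₀`; by convexity `g` keeps growing at least linearly beyond it.
    set s := (R + 1) / ‖x - p‖ with hs
    have hs0 : 0 < s := by positivity
    have hs1 : s ≤ 1 := by rw [hs, div_le_one ht0]; exact ht.le
    obtain ⟨a1, a2⟩ := hP.g_pcl.segment (hP.solG_edom hp) hx' hs0.le hs1
    have a3 : r₀ < (P.g (p + s • (x - p))).toReal := by
      by_contra hle
      have := hR (hP.g_pcl.le_of_toReal_le a1 (not_lt.1 hle))
      rw [Metric.mem_closedBall, dist_eq_norm, add_sub_cancel_left, norm_smul,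
        Real.norm_of_nonneg hs0.le, hs, div_mul_cancel₀ _ ht0.ne'] at this
      linarith
    have a4 : (P.g x).toReal ≤ r := hP.g_pcl.toReal_le hx
    have a5 : r₀ - m < s * (r - m) := by
      have : s * (P.g x).toReal ≤ s * r := by gcongr
      nlinarith
    rw [le_div_iff₀ (by linarith)]
    have a6 : ‖x - p‖ * s = R + 1 := by rw [hs]; field_simp
    nlinarith

/-- `f` is bounded on bounded subsets of its domain. -/
lemma exists_abs_f_le {s : Set (Sp n)} (hs : Bornology.IsBounded s) :
    ∃ U : ℝ, 0 ≤ U ∧ ∀ x ∈ s, x ∈ edom P.f → |(P.f x).toReal| ≤ U := by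
  obtain ⟨w, hw⟩ := hP.f_pcl.nonempty_dom
  obtain ⟨R, hR0, hR⟩ := hs.subset_closedBall_lt 0 w
  obtain ⟨K, hK⟩ := (isCompact_closedBall w R).exists_bound_of_continuousOn
    hP.f₁_contDiff.continuous.continuousOn
  have hK0 : 0 ≤ K := (norm_nonneg _).trans (hK w (by simp [hR0.le]))
  refine ⟨K + |(P.f₂ w).toReal| + P.lf₂ * R, by positivity, fun x hx hxf => ?_⟩
  have h1 := hK x (hR hx)
  have h2 := hP.f₂_lip.dist_le_mul x (hP.mem_edom_f.1 hxf) w (hP.mem_edom_f.1 hw)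
  have h3 : (P.lf₂ : ℝ) * dist x w ≤ P.lf₂ * R := by
    have := hR hx
    rw [Metric.mem_closedBall] at this
    gcongr
  rw [hP.toReal_f hxf]
  rw [Real.dist_eq] at h2
  rw [Real.norm_eq_abs] at h1
  have h4 : (P.f₂ x).toReal = ((P.f₂ x).toReal - (P.f₂ w).toReal) + (P.f₂ w).toReal := by ring
  have h5 := abs_add_le (P.f₁ x) (P.f₂ x).toReal
  have h6 := abs_add_le ((P.f₂ x).toReal - (P.f₂ w).toReal) (P.f₂ w).toReal
  rw [← h4] at h6
  linarith

lemma bddAbove_gradient {s : Set (Sp n)} (hs : Bornology.IsBounded s) :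
    BddAbove ((fun x => ‖gradient P.f₁ x‖) '' s) := by
  obtain ⟨R, hR⟩ := hs.subset_closedBall 0
  have hc : Continuous fun x => ‖gradient P.f₁ x‖ := hP.f₁_lip.continuous.norm
  exact ((isCompact_closedBall (0 : Sp n) R).bddAbove_image hc.continuousOn).mono
    (Set.image_mono hR)

/-- `f` is Lipschitz on the bounded level sets of `g`. -/
lemma f_sub_le {r : ℝ} (hb : Bornology.IsBounded (lev P.g r)) {x y : Sp n} (hx : x ∈ lev P.g r)
    (hxf : x ∈ edom P.f) (hyf : y ∈ edom P.f) :
    (P.f x).toReal - (P.f y).toReal ≤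
      (sSup ((fun x => ‖gradient P.f₁ x‖) '' lev P.g r) + P.lf₂) * ‖x - y‖ := by
  -- Only the gradient at `x` enters, so `y` need not lie in the level set.
  have h1 := gradient_inner_le_of_convexOn hP.f₁_convex
    (hP.f₁_contDiff.differentiable one_ne_zero) x y
  have h2 : ‖gradient P.f₁ x‖ ≤ sSup ((fun x => ‖gradient P.f₁ x‖) '' lev P.g r) :=
    le_csSup (hP.bddAbove_gradient hb) ⟨x, hx, rfl⟩
  have h3 : inner ℝ (gradient P.f₁ x) (x - y) ≤
      sSup ((fun x => ‖gradient P.f₁ x‖) '' lev P.g r) * ‖x - y‖ :=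
    (real_inner_le_norm _ _).trans (by gcongr)
  have h4 := hP.f₂_lip.dist_le_mul x (hP.mem_edom_f.1 hxf) y (hP.mem_edom_f.1 hyf)
  rw [Real.dist_eq, dist_eq_norm] at h4
  have h5 := le_abs_self ((P.f₂ x).toReal - (P.f₂ y).toReal)
  rw [← neg_sub x y, inner_neg_right] at h1
  rw [hP.toReal_f hxf, hP.toReal_f hyf]
  linarith

lemma coe_gBar {c : ℝ} {x : Sp n} (hx : x ∈ edom P.g) (hxc : P.f x ≤ (c : EReal)) :
    (((P.gBar c).toReal : ℝ) : EReal) = P.gBar c := by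
  refine EReal.coe_toReal (ne_top_of_le_ne_top hx (iInf₂_le x (EReal.sub_nonpos.2 hxc))) ?_
  obtain ⟨p, hp⟩ := hP.solG_nontrivial.nonempty
  have : P.g p ≤ P.gBar c := le_iInf₂ fun y _ => hp y
  exact ne_bot_of_le_ne_bot (hP.g_pcl.ne_bot p) this

/-- Nearly feasible, nearly optimal points of `min {g : f ≤ c}` are close to solutions. -/
lemma exists_solution_near (hb : ∀ r, Bornology.IsBounded (lev P.g r)) (c gb : ℝ) {η : ℝ}
    (hη : 0 < η) : ∃ δ : ℝ, 0 < δ ∧ ∀ x ∈ lev P.g (gb + δ), x ∈ lev P.f (c + δ) →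
      ∃ s ∈ lev P.g gb, s ∈ lev P.f c ∧ ‖s - x‖ ≤ η := by
  by_contra hcon
  push Not at hcon
  -- Counterexamples for `δ = 1 / (k + 1)` lie in a compact level set; by lower semicontinuity a
  -- cluster point is a solution, and some counterexample is within `η` of it.
  choose! x hx1 hx2 hx3 using hcon
  set δ : ℕ → ℝ := fun k => 1 / ((k : ℝ) + 1) with hδ
  have hδ0 : ∀ k, 0 < δ k := fun k => by positivity
  have hδ1 : ∀ k, δ k ≤ 1 := fun k => by
    rw [hδ]
    simp only
    rw [div_le_one (by positivity)]
    linarith [(Nat.cast_nonneg k : (0 : ℝ) ≤ k)]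
  have hK : IsCompact (lev P.g (gb + 1)) :=
    Metric.isCompact_of_isClosed_isBounded (hP.isClosed_lev_g _) (hb _)
  obtain ⟨a, -, φ, hφ, ha⟩ := hK.tendsto_subseq (x := fun k => x (δ k)) fun k =>
    lev_mono P.g (by linarith [hδ1 k]) (hx1 _ (hδ0 k))
  have hδt : Filter.Tendsto (fun k => δ (φ k)) Filter.atTop (nhds 0) :=
    (tendsto_one_div_add_atTop_nhds_zero_nat (𝕜 := ℝ)).comp hφ.tendsto_atTop
  have lim : ∀ (ψ : Sp n → EReal), ProperConvexLsc ψ → ∀ r : ℝ,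
      (∀ d, 0 < d → x d ∈ lev ψ (r + d)) → a ∈ lev ψ r := by
    intro ψ hψ r hr
    have h1 : ∀ d : ℝ, 0 < d → a ∈ lev ψ (r + d) := fun d hd => by
      refine (hψ.lsc.isClosed_preimage _ : IsClosed (lev ψ (r + d))).mem_of_tendsto ha ?_
      filter_upwards [hδt.eventually (gt_mem_nhds hd)] with k hk
      exact lev_mono ψ (by linarith) (hr _ (hδ0 _))
    have h2 := ProperConvexLsc.mem_edom_of_le (h1 1 one_pos)
    refine hψ.le_of_toReal_le h2 (le_of_forall_pos_le_add fun d hd => ?_)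
    exact hψ.toReal_le (h1 d hd)
  have hag := lim P.g hP.g_pcl gb hx1
  have haf := lim P.f hP.f_pcl c hx2
  have h3 : ∀ᶠ k in Filter.atTop, ‖a - x (δ (φ k))‖ < η := by
    have := (ha.eventually (Metric.ball_mem_nhds a hη))
    filter_upwards [this] with k hk
    rwa [← dist_eq_norm, dist_comm]
  obtain ⟨k, hk⟩ := h3.exists
  exact absurd (hx3 _ (hδ0 _) a hag haf) (not_lt.2 hk.le)

/-- Attainment of the infimum comes from the previous lemma, applied to a feasible point with value
below `gBar + δ`. -/
lemma exists_solution (hb : ∀ r, Bornology.IsBounded (lev P.g r)) {c : ℝ} {x : Sp n}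
    (hx : x ∈ edom P.g) (hxc : P.f x ≤ (c : EReal)) :
    ∃ s ∈ lev P.g (P.gBar c).toReal, s ∈ lev P.f c := by
  obtain ⟨δ, hδ, h⟩ := hP.exists_solution_near hb c (P.gBar c).toReal one_pos
  have h1 : P.gBar c < (((P.gBar c).toReal + δ : ℝ) : EReal) := by
    nth_rewrite 1 [← hP.coe_gBar hx hxc]
    exact_mod_cast lt_add_of_pos_right _ hδ
  simp only [Problem.gBar, iInf_lt_iff] at h1
  obtain ⟨y, hy, hy'⟩ := h1
  obtain ⟨s, hs, hs', -⟩ := h y hy'.le (lev_mono P.f (by linarith) (EReal.sub_nonpos.1 hy))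
  exact ⟨s, hs, hs'⟩

end Basic

end Problem

/-! ### The penalized problems -/

namespace Setup

/-- The assumptions on the data, with a first restriction on the accuracy. -/
structure Regular (S : Setup n) (Γ : ℝ) : Prop where
  basic : S.P.Basic
  adm : S.Admissible Γ
  one_lt : 1 < S.γ₁
  one_le : 1 ≤ S.γ₂
  Δ₁_pos : 0 < S.Δ₁
  ε_pos : 0 < S.ε
  ε_le : S.ε ≤ 1 / 2
  ε_le_Lmin : S.ε ≤ S.Lmin

/-- The assumptions on the data in the regime of small accuracies. -/
structure Standing (S : Setup n) (Γ : ℝ) : Prop extends S.Regular Γ where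
  small : (2 * S.Dz + 1 / S.Δ₁ ^ 2) * S.ε ≤ 1 / 4

/-- `x` is nearly optimal for the regularized problem with multiplier `z`. -/
structure Near (S : Setup n) (z : ℝ) (x : Sp n) : Prop where
  mem : x ∈ edom S.P.g
  mem_X : 0 < z → x ∈ S.P.X
  le : ∀ u ∈ S.P.X,
    (S.P.g x).toReal + S.ε / 2 * ‖x - S.x0‖ ^ 2 + z * (S.P.f x).toReal + S.ε / 2 * ‖u - x‖ ^ 2 ≤
      (S.P.g u).toReal + S.ε / 2 * ‖u - S.x0‖ ^ 2 + z * (S.P.f u).toReal + S.ε₁ * ‖u - x‖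

/-- The nonsmooth part of the penalized objective. -/
def pen (S : Setup n) (z : ℝ) (x : Sp n) : EReal := S.P.g₂ x + (z : EReal) * S.P.f₂ x

lemma pen_zero (S : Setup n) : S.pen 0 = S.P.g₂ := by
  funext x
  simp [pen]

lemma Dg_nonneg (S : Setup n) : 0 ≤ S.Dg := Metric.diam_nonneg

lemma Bf_nonneg (S : Setup n) : 0 ≤ S.Bf := by
  have h1 : (0 : ℝ) ≤ S.P.lf₂ := S.P.lf₂.2
  have h2 : 0 ≤ sSup ((fun x => ‖gradient S.P.f₁ x‖) '' lev S.P.g S.DL) :=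
    Real.sSup_nonneg (by rintro _ ⟨x, -, rfl⟩; exact norm_nonneg _)
  rw [Bf]
  linarith

lemma Bf_le_D (S : Setup n) : (1 + S.Dg * (1 + S.Dg)) * S.Bf ≤ S.D := by
  have := S.Dg_nonneg
  exact mul_le_mul_of_nonneg_left (le_max_left _ _) (by positivity)

namespace Regular

variable {S : Setup n} {Γ : ℝ} (H : S.Regular Γ)
include H

lemma f_x0_lt : S.P.f S.x0 < ((S.c - S.Δ₁ : ℝ) : EReal) := by
  have h := H.adm.regular
  rw [Problem.fc] at h
  by_cases ht : S.P.f S.x0 = ⊤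
  · rw [ht, EReal.top_sub_coe] at h
    exact absurd h not_top_lt
  · rw [← H.basic.f_pcl.coe_toReal ht, ← EReal.coe_sub, EReal.coe_lt_coe_iff] at h
    rw [← H.basic.f_pcl.coe_toReal ht, EReal.coe_lt_coe_iff]
    linarith

lemma x0_mem : S.x0 ∈ S.P.X :=
  ⟨ne_top_of_lt H.f_x0_lt, ProperConvexLsc.mem_edom_of_le H.adm.x0_lev⟩

lemma X_nonempty : S.P.X.Nonempty := ⟨_, H.x0_mem⟩

lemma f_x0_lt' : (S.P.f S.x0).toReal < S.c - S.Δ₁ := by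
  have := H.f_x0_lt
  rwa [← H.basic.f_pcl.coe_toReal H.x0_mem.1, EReal.coe_lt_coe_iff] at this

lemma f_x0_le : (S.P.f S.x0).toReal ≤ S.P.fStar.toReal + S.ε := by
  have := H.adm.x0_opt
  rwa [← H.basic.f_pcl.coe_toReal H.x0_mem.1, ← H.basic.coe_fStar H.X_nonempty, ← EReal.coe_add,
    EReal.coe_le_coe_iff] at this

lemma g_x0_le : (S.P.g S.x0).toReal ≤ Γ := H.basic.g_pcl.toReal_le H.adm.x0_lev

lemma xg_le : S.P.g S.xg ≤ ((S.P.gStar.toReal + S.ε : ℝ) : EReal) := by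
  rw [EReal.coe_add, H.basic.coe_gStar H.X_nonempty]
  exact H.adm.xg_opt

lemma xg_mem : S.xg ∈ S.P.X := ⟨H.adm.xg_dom, ProperConvexLsc.mem_edom_of_le H.xg_le⟩

lemma g_xg_le : (S.P.g S.xg).toReal ≤ S.P.gStar.toReal + S.ε := H.basic.g_pcl.toReal_le H.xg_le

lemma Dz_mul : S.Dz * S.Δ₁ = (S.P.g S.x0).toReal - (S.P.g S.xg).toReal + 1 := by
  rw [Dz, div_mul_cancel₀ _ H.Δ₁_pos.ne']

/-- The `+ 1` in `Dz` pays for the inexactness of `xg`, whose value may exceed that of `x0` by at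
most `ε`. -/
lemma half_le_Dz_mul : 1 / 2 ≤ S.Dz * S.Δ₁ := by
  have h1 := H.basic.gStar_le H.x0_mem
  have h2 := H.g_xg_le
  have h3 := H.ε_le
  rw [H.Dz_mul]
  linarith

lemma Dz_pos : 0 < S.Dz := by
  have := H.half_le_Dz_mul
  exact pos_of_mul_pos_left (by linarith) H.Δ₁_pos.le

lemma one_le_Lphi : 1 ≤ S.Lphi := by
  have := H.Dz_pos
  have h1 : (0 : ℝ) ≤ S.P.Lg₁ := S.P.Lg₁.2
  have h2 : (0 : ℝ) ≤ S.P.Lf₁ := S.P.Lf₁.2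
  have : 0 ≤ 2 * S.Dz * S.P.Lf₁ := by positivity
  rw [Lphi]
  linarith

lemma add_Δ₁_le : (S.P.f S.x0).toReal + S.Δ₁ ≤ S.u₀ := by
  have h1 := H.f_x0_lt'
  have h2 := H.adm.c_le
  linarith

/-- Since `f^* + Δ₁ ≤ u₀`, the last two terms of `D₀` add up to at least `2 * Dz * Δ₁ ≥ 1`. -/
lemma add_one_le_D₀ : (S.P.g S.x0).toReal + 1 ≤ S.D₀ := by
  have h1 := H.basic.fStar_le H.x0_mem
  have h2 := H.add_Δ₁_le
  have h3 := H.half_le_Dz_mul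
  have h4 := H.Dz_pos
  have h5 := le_max_right 0 (-2 * S.Dz * S.P.fStar.toReal)
  have h6 : S.Dz * (S.P.fStar.toReal + S.Δ₁) ≤ S.Dz * |S.u₀| :=
    mul_le_mul_of_nonneg_left ((by linarith : S.P.fStar.toReal + S.Δ₁ ≤ S.u₀).trans
      (le_abs_self _)) h4.le
  rw [D₀]
  linarith

lemma D₀_le_DL : S.D₀ ≤ S.DL := by
  have h1 := H.one_lt
  have h2 := H.one_le_Lphi
  have : 0 ≤ S.γ₁ * S.Lphi * S.R₁ ^ 2 := by positivity
  rw [DL]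
  linarith

lemma mem_lev_DL {x : Sp n} (hx : x ∈ edom S.P.g) (h : (S.P.g x).toReal ≤ (S.P.g S.x0).toReal + 1) :
    x ∈ lev S.P.g S.DL :=
  H.basic.g_pcl.le_of_toReal_le hx (h.trans (H.add_one_le_D₀.trans H.D₀_le_DL))

lemma x0_mem_lev : S.x0 ∈ lev S.P.g S.DL := H.mem_lev_DL H.x0_mem.2 (by linarith)

lemma xg_mem_lev : S.xg ∈ lev S.P.g S.DL :=
  H.mem_lev_DL H.xg_mem.2 (by
    have h1 := H.g_xg_le
    have h2 := H.basic.gStar_le H.x0_mem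
    have h3 := H.ε_le
    linarith)

lemma norm_sub_le_Dg {x y : Sp n} (hx : x ∈ lev S.P.g S.DL) (hy : y ∈ lev S.P.g S.DL) :
    ‖x - y‖ ≤ S.Dg := by
  rw [← dist_eq_norm]
  exact Metric.dist_le_diam_of_mem H.adm.bdd hx hy

lemma f_sub_le {x y : Sp n} (hx : x ∈ lev S.P.g S.DL) (hxf : x ∈ edom S.P.f)
    (hyf : y ∈ edom S.P.f) : (S.P.f x).toReal - (S.P.f y).toReal ≤ S.Bf * ‖x - y‖ :=
  H.basic.f_sub_le H.adm.bdd hx hxf hyf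

/-- Between `x0` and `xg`, both in the level set, `f` rises by at least `Δ₁`. This bounds `D` below
independently of `ε`, so that the tolerances `ε₁` and `ε₄` are `O(ε²)`. -/
lemma Δ₁_le_mul : S.Δ₁ ≤ S.Bf * S.Dg := by
  have h1 := H.f_sub_le H.xg_mem_lev H.xg_mem.1 H.x0_mem.1
  have h2 := H.add_Δ₁_le
  have h3 := mul_le_mul_of_nonneg_left (H.norm_sub_le_Dg H.xg_mem_lev H.x0_mem_lev) S.Bf_nonneg
  have h4 : S.u₀ = (S.P.f S.xg).toReal := rfl
  linarith

lemma Δ₁_le_D : S.Δ₁ ≤ S.D := by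
  have h1 := H.Δ₁_le_mul
  have h2 := S.Bf_le_D
  have h3 := S.Dg_nonneg
  have h4 := S.Bf_nonneg
  have : 0 ≤ (1 + S.Dg * S.Dg) * S.Bf := by positivity
  linarith

lemma D_pos : 0 < S.D := H.Δ₁_pos.trans_le H.Δ₁_le_D

lemma ε₁_pos : 0 < S.ε₁ := by
  have := H.ε_pos
  have := H.D_pos
  rw [ε₁]; positivity

lemma ε₄_pos : 0 < S.ε₄ := H.ε₁_pos

lemma ε₁_le : S.ε₁ ≤ S.ε ^ 2 / S.Δ₁ := by
  have := H.Δ₁_pos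
  have := H.Δ₁_le_D
  rw [ε₁]; gcongr

lemma ε₄_le : S.ε₄ ≤ S.ε ^ 2 / S.Δ₁ := H.ε₁_le

lemma ε₂_nonneg : 0 ≤ S.ε₂ := by
  have := H.ε_pos
  have := H.D_pos
  have := S.Bf_nonneg
  rw [ε₂]; positivity

lemma ε₂_le : S.ε₂ ≤ S.ε := by
  have h1 := H.ε_pos
  have h2 := S.Bf_le_D
  have h3 := S.Bf_nonneg
  have h4 := S.Dg_nonneg
  have h5 : 0 ≤ S.Dg * (1 + S.Dg) * S.Bf := by positivity
  rw [ε₂, div_le_iff₀ H.D_pos]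
  nlinarith

/-- The source of the slack in the final error budget: `ε₃` is smaller than `ε` by a definite factor
once `Dg` is bounded away from zero. -/
lemma ε₃_mul_le : S.ε₃ * (1 + S.Dg * (1 + S.Dg)) ≤ S.ε := by
  have h1 := H.ε_pos
  have h4 := S.Dg_nonneg
  have h2 : (1 + S.Dg * (1 + S.Dg)) * (2 * S.Dz * S.Bf + 2 * S.Dz * S.Bf ^ 2) ≤ S.D :=
    mul_le_mul_of_nonneg_left (le_max_right _ _) (by positivity)
  rw [ε₃, div_mul_eq_mul_div, div_le_iff₀ H.D_pos]
  nlinarith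

lemma ε₃_nonneg : 0 ≤ S.ε₃ := by
  have := H.ε_pos
  have := H.D_pos
  have := S.Bf_nonneg
  have := H.Dz_pos
  rw [ε₃]; positivity

/-! #### The penalized objective -/

/-- At `z = 0` the convention `0 * ⊤ = 0` removes `f₂` and enlarges the domain from `X` to `dom g`;
hence the case distinction here and below. -/
lemma pen_pcl {z : ℝ} (hz : 0 ≤ z) : ProperConvexLsc (S.pen z) := by
  rcases hz.eq_or_lt with rfl | hz
  · rw [pen_zero]; exact H.basic.g₂_pcl
  · refine H.basic.g₂_pcl.add (H.basic.f₂_pcl.coe_mul hz) ⟨S.x0, ?_, ?_⟩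
    · exact H.basic.mem_edom_g.1 H.x0_mem.2
    · rw [H.basic.f₂_pcl.edom_coe_mul hz]
      exact H.basic.mem_edom_f.1 H.x0_mem.1

lemma edom_pen {z : ℝ} (hz : 0 < z) : edom (S.pen z) = S.P.X := by
  have := ProperConvexLsc.edom_add H.basic.g₂_pcl (H.basic.f₂_pcl.coe_mul hz)
  rw [H.basic.f₂_pcl.edom_coe_mul hz] at this
  refine this.trans ?_
  ext x
  rw [Set.mem_inter_iff, ← H.basic.mem_edom_f, ← H.basic.mem_edom_g, and_comm]
  rfl

lemma edom_pen_zero : edom (S.pen 0) = edom S.P.g := by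
  ext x
  rw [pen_zero, H.basic.mem_edom_g]

lemma X_subset {z : ℝ} (hz : 0 ≤ z) : S.P.X ⊆ edom (S.pen z) := by
  rcases hz.eq_or_lt with rfl | hz
  · rw [H.edom_pen_zero]; exact fun x hx => hx.2
  · rw [H.edom_pen hz]

lemma mem_of_mem_pen {z : ℝ} (hz : 0 ≤ z) {x : Sp n} (hx : x ∈ edom (S.pen z)) :
    x ∈ edom S.P.g ∧ (0 < z → x ∈ S.P.X) := by
  rcases hz.eq_or_lt with rfl | hz
  · rw [H.edom_pen_zero] at hx
    exact ⟨hx, fun h => absurd h (lt_irrefl _)⟩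
  · rw [H.edom_pen hz] at hx
    exact ⟨hx.2, fun _ => hx⟩

lemma penalized_eq {z : ℝ} (hz : 0 ≤ z) {x : Sp n} (hx : x ∈ edom (S.pen z)) :
    S.P.g₁ x + S.ε / 2 * ‖x - S.x0‖ ^ 2 + z * S.P.f₁ x + (S.pen z x).toReal =
      (S.P.g x).toReal + S.ε / 2 * ‖x - S.x0‖ ^ 2 + z * (S.P.f x).toReal := by
  rcases hz.eq_or_lt with rfl | hz
  · rw [H.edom_pen_zero] at hx
    rw [pen_zero, H.basic.toReal_g hx]
    ring
  · rw [H.edom_pen hz] at hx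
    have h1 := H.basic.mem_edom_g.1 hx.2
    have h2 := H.basic.mem_edom_f.1 hx.1
    have h3 := (H.basic.f₂_pcl.coe_mul hz).ne_bot x
    have h4 : x ∈ edom fun x => (z : EReal) * S.P.f₂ x := by
      rwa [H.basic.f₂_pcl.edom_coe_mul hz]
    rw [pen, EReal.toReal_add h1 (H.basic.g₂_pcl.ne_bot x) h4 h3, EReal.toReal_mul,
      EReal.toReal_coe, H.basic.toReal_g hx.2, H.basic.toReal_f hx.1]
    ring

/-- The strong convexity used comes from the proximal term alone; the `+ 1` in `Lphi` covers its
contribution `ε` to the Lipschitz constant. -/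
lemma smooth {z : ℝ} (hz : 0 ≤ z) (hz' : z ≤ 2 * S.Dz) :
    StronglyConvexSmooth (fun x => S.P.g₁ x + S.ε / 2 * ‖x - S.x0‖ ^ 2 + z * S.P.f₁ x)
      S.ε S.Lphi := by
  have h1 := StronglyConvexSmooth.of_convexOn H.basic.g₁_convex H.basic.g₁_contDiff H.basic.g₁_lip
  have h2 := StronglyConvexSmooth.of_convexOn H.basic.f₁_convex H.basic.f₁_contDiff H.basic.f₁_lip
  have h3 := (h1.add (StronglyConvexSmooth.half_sq_dist S.x0 H.ε_pos.le)).add (h2.const_mul hz)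
  rw [zero_add, mul_zero, add_zero] at h3
  refine h3.mono ?_
  have h4 : z * (S.P.Lf₁ : ℝ) ≤ 2 * S.Dz * S.P.Lf₁ := by gcongr
  have h5 := H.ε_le
  rw [Lphi]
  linarith

/-- The results of the inner method are nearly optimal. -/
lemma near_of_call {z : ℝ} (hz : 0 ≤ z) (hz' : z ≤ 2 * S.Dz) {y x : Sp n} {N : ℕ}
    (h : S.Call z y x N) : S.Near z x := by
  obtain ⟨h1, h2⟩ := h.nearStationary.near_optimal (H.smooth hz hz') (H.pen_pcl hz) H.ε₁_pos.le
  obtain ⟨h3, h4⟩ := H.mem_of_mem_pen hz h1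
  refine ⟨h3, h4, fun u hu => ?_⟩
  have h5 := h2 u (H.X_subset hz hu)
  have h6 := H.penalized_eq hz h1
  have h7 := H.penalized_eq hz (H.X_subset hz hu)
  linarith

/-- Existence of the calls of the inner method, and a bound for their cost. -/
lemma call {p : Sp n} (hp : p ∈ S.P.solG) {z Lbar : ℝ} (hz : 0 ≤ z) (hz' : z ≤ 2 * S.Dz)
    (h1 : S.Lmin ≤ Lbar) (h2 : S.γ₁ * S.Lphi ≤ Lbar) {y : Sp n} (hy : y ∈ lev S.P.g S.DL) (j : ℕ)
    (hj : (1 - √(S.ε / Lbar)) ^ (j + 1) *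
      (32 * (Γ - (S.P.g p).toReal + 4 * S.Dz * (|S.P.fStar.toReal| + 1) + Lbar / 2 * S.Dg ^ 2) *
        Lbar ^ 2 / S.Lmin) ≤ S.ε₁ ^ 2) :
    (∃ x N, S.Call z y x N) ∧ ∀ x N, S.Call z y x N →
      (N : ℝ) ≤ (j + 2) * (8 * (1 + Real.log (Lbar / S.Lmin) / Real.log S.γ₁) + 1) := by
  have hε := H.ε_pos
  have hDz := H.Dz_pos
  have hm : 0 < S.Lmin := hε.trans_le H.ε_le_Lmin
  have hLbar : 0 < Lbar := hm.trans_le h1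
  have key : APGData (fun x => S.P.g₁ x + S.ε / 2 * ‖x - S.x0‖ ^ 2 + z * S.P.f₁ x) (S.pen z)
      S.γ₁ S.γ₂ S.Lmin S.ε S.Lphi Lbar ((S.P.g p).toReal - 2 * S.Dz * |S.P.fStar.toReal|) S.x0 := by
    refine ⟨H.smooth hz hz', H.pen_pcl hz, H.one_lt, H.one_le, hε, H.ε_le_Lmin, h1,
      by linarith [H.one_le_Lphi], h2, fun x hx => ?_⟩
    obtain ⟨a1, a2⟩ := H.mem_of_mem_pen hz hx
    have a3 := H.basic.solG_le hp a1
    have a4 : -(2 * S.Dz * |S.P.fStar.toReal|) ≤ z * (S.P.f x).toReal := by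
      rcases hz.eq_or_lt with rfl | hz0
      · have : 0 ≤ 2 * S.Dz * |S.P.fStar.toReal| := by positivity
        linarith
      · have b1 := H.basic.fStar_le (a2 hz0)
        have b2 := neg_abs_le S.P.fStar.toReal
        have b3 : z * -|S.P.fStar.toReal| ≤ z * (S.P.f x).toReal :=
          mul_le_mul_of_nonneg_left (b2.trans b1) hz
        have b4 : z * |S.P.fStar.toReal| ≤ 2 * S.Dz * |S.P.fStar.toReal| := by gcongr
        linarith
    rw [H.penalized_eq hz hx]
    linarith
  -- The comparison point is `x0`: its proximal term vanishes, and `f x0` is within `ε` of `f^*`, so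
  -- the initial gap is bounded uniformly in `z` and in the starting point.
  refine key.run (H.X_subset hz H.x0_mem) H.ε₁_pos.le j (le_trans ?_ hj)
  have hq0 : 0 ≤ 1 - √(S.ε / Lbar) := by
    have := Real.sqrt_le_one.2 ((div_le_one hLbar).2 (H.ε_le_Lmin.trans h1))
    linarith
  have c1 : z * (S.P.f S.x0).toReal ≤ 2 * S.Dz * (|S.P.fStar.toReal| + 1) := by
    have d1 := H.f_x0_le
    have d2 := le_abs_self S.P.fStar.toReal
    have d3 := H.ε_le
    calc z * (S.P.f S.x0).toReal ≤ z * (|S.P.fStar.toReal| + 1) := by gcongr; linarith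
      _ ≤ _ := by gcongr
  have c2 := H.g_x0_le
  have c3 : Lbar / 2 * ‖S.x0 - y‖ ^ 2 ≤ Lbar / 2 * S.Dg ^ 2 := by
    have := H.norm_sub_le_Dg H.x0_mem_lev hy
    gcongr
  rw [H.penalized_eq hz (H.X_subset hz H.x0_mem), sub_self, norm_zero]
  gcongr
  linarith

/-! #### Properties of nearly optimal points -/

/-- Needed where no bound on the distance `r` is known yet: the quadratic term absorbs the linear
error. -/
lemma ε₁_mul_sub_le (r : ℝ) (hr : 0 ≤ r) : S.ε₁ * r - S.ε * r ^ 2 ≤ 1 / S.Δ₁ ^ 2 * S.ε := by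
  have h1 := mul_le_mul_of_nonneg_right H.ε₁_le hr
  have h2 := H.ε_pos
  have h3 := H.Δ₁_pos
  have h4 : S.ε ^ 2 / S.Δ₁ * r - S.ε * r ^ 2 ≤ S.ε * (S.ε / S.Δ₁) ^ 2 := by
    have : S.ε ^ 2 / S.Δ₁ * r = S.ε * (S.ε / S.Δ₁ * r) := by ring
    rw [this]
    have : S.ε / S.Δ₁ * r - r ^ 2 ≤ (S.ε / S.Δ₁) ^ 2 := by
      nlinarith [sq_nonneg (S.ε / S.Δ₁ - r), sq_nonneg r, sq_nonneg (S.ε / S.Δ₁)]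
    nlinarith
  have h5 : (S.ε / S.Δ₁) ^ 2 ≤ (1 / S.Δ₁) ^ 2 := by
    have := H.ε_le
    gcongr
    linarith
  have h6 : S.ε * (S.ε / S.Δ₁) ^ 2 ≤ S.ε * (1 / S.Δ₁) ^ 2 := by gcongr
  rw [one_div_pow] at h6
  linarith

end Regular

namespace Standing

variable {S : Setup n} {Γ : ℝ} (H : S.Standing Γ)
include H

lemma near_le {z : ℝ} {x : Sp n} (h : S.Near z x) :
    (S.P.g x).toReal + z * (S.P.f x).toReal ≤
      (S.P.g S.x0).toReal + z * (S.P.f S.x0).toReal + 1 / S.Δ₁ ^ 2 * S.ε := by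
  have h1 := h.le S.x0 H.x0_mem
  have h2 := H.ε₁_mul_sub_le ‖S.x0 - x‖ (norm_nonneg _)
  rw [norm_sub_rev x S.x0, sub_self, norm_zero] at h1
  linarith

/-- Relative to `x0`, the term `z f` can drop by at most `2 * Dz * ε`, so `g` can rise only
slightly. Hence each result is a legitimate start for the next call, and the constants `Dg` and `Bf`
apply to it. -/
lemma near_mem_lev {z : ℝ} (hz : 0 ≤ z) (hz' : z ≤ 2 * S.Dz) {x : Sp n} (h : S.Near z x) :
    x ∈ lev S.P.g S.DL := by
  refine H.mem_lev_DL h.mem ?_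
  have h1 := H.near_le h
  have h2 := H.small
  have h3 := H.ε_pos
  have h4 : z * (S.P.f S.x0).toReal - z * (S.P.f x).toReal ≤ 2 * S.Dz * S.ε := by
    rcases hz.eq_or_lt with rfl | hz0
    · have := H.Dz_pos
      have : 0 ≤ 2 * S.Dz * S.ε := by positivity
      linarith
    · have a1 := H.basic.fStar_le (h.mem_X hz0)
      have a2 := H.f_x0_le
      calc _ = z * ((S.P.f S.x0).toReal - (S.P.f x).toReal) := by ring
        _ ≤ z * S.ε := by gcongr; linarith
        _ ≤ _ := by gcongr
  linarith

lemma nearFeasible_of_le {x : Sp n} (hx : x ∈ edom S.P.f) (h : (S.P.f x).toReal - S.c ≤ S.ε₂) :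
    S.NearFeasible x := by
  refine max_le ?_ (by exact_mod_cast H.ε₂_nonneg)
  rw [Problem.fc, ← H.basic.f_pcl.coe_toReal hx, ← EReal.coe_sub]
  exact_mod_cast h

lemma le_of_nearFeasible {x : Sp n} (h : S.NearFeasible x) :
    x ∈ edom S.P.f ∧ (S.P.f x).toReal - S.c ≤ S.ε₂ := by
  have h1 : S.P.fc S.c x ≤ (S.ε₂ : EReal) := (le_max_left _ _).trans h
  have hx : x ∈ edom S.P.f := by
    intro ht
    rw [Problem.fc, ht, EReal.top_sub_coe, top_le_iff] at h1
    exact EReal.coe_ne_top _ h1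
  refine ⟨hx, ?_⟩
  rw [Problem.fc, ← H.basic.f_pcl.coe_toReal hx, ← EReal.coe_sub] at h1
  exact_mod_cast h1

lemma nearCompl_iff {z : ℝ} {x : Sp n} (hx : x ∈ edom S.P.f) :
    S.NearCompl z x ↔ -S.ε₃ ≤ z * ((S.P.f x).toReal - S.c) ∧
      z * ((S.P.f x).toReal - S.c) ≤ S.ε₃ := by
  rw [NearCompl, Problem.fc, ← H.basic.f_pcl.coe_toReal hx, ← EReal.coe_sub, ← EReal.coe_mul,
    EReal.coe_le_coe_iff, EReal.coe_le_coe_iff, EReal.toReal_coe]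

/-- Slater's bound on multipliers: comparison with `x0` shows that a positive `f x - c` would
require `z * Δ₁` to be less than the possible decrease of `g` plus small errors, which `Dz * Δ₁`
dominates. -/
lemma nearFeasible_of_Dz_lt {z : ℝ} (hz : S.Dz < z) {x : Sp n} (h : S.Near z x) :
    S.NearFeasible x := by
  have hz0 := H.Dz_pos.trans hz
  have hX := h.mem_X hz0
  have h1 := H.near_le h
  have h2 := H.small
  have h3 := H.basic.gStar_le hX
  have h4 := H.g_xg_le
  have h5 := H.f_x0_lt'
  have h6 : z * (S.P.f S.x0).toReal ≤ z * (S.c - S.Δ₁) := by gcongr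
  have h7 := H.Dz_mul
  have h8 : S.Dz * S.Δ₁ ≤ z * S.Δ₁ := by
    have := H.Δ₁_pos
    gcongr
  have h9 := H.ε_le
  have h10 : 0 ≤ 2 * S.Dz * S.ε := by
    have := H.Dz_pos
    have := H.ε_pos
    positivity
  refine H.nearFeasible_of_le hX.1 ?_
  have h11 : z * ((S.P.f x).toReal - S.c) ≤ 0 := by linarith
  have h12 := nonpos_of_mul_nonpos_right h11 hz0
  exact h12.trans H.ε₂_nonneg

/-- Approximate complementarity at the right end of a short interval whose left end is
infeasible. -/
lemma neg_mul_le_of_short {a b : ℝ} {xa xb : Sp n} (ha : 0 < a) (hab : a ≤ b) (hb : b ≤ 2 * S.Dz)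
    (hlen : b - a ≤ S.ε₄) (hxa : S.Near a xa) (hxb : S.Near b xb) (hfa : ¬ S.NearFeasible xa) :
    -(b * ((S.P.f xb).toReal - S.c)) ≤ S.ε₃ := by
  have hXa := hxa.mem_X ha
  have hXb := hxb.mem_X (ha.trans_le hab)
  have la := H.near_mem_lev ha.le (hab.trans hb) hxa
  have h1 : S.ε₂ < (S.P.f xa).toReal - S.c := by
    by_contra hcon
    exact hfa (H.nearFeasible_of_le hXa.1 (not_lt.1 hcon))
  have h2 := hxa.le xb hXb
  have h3 := hxb.le xa hXa
  have h4 := H.f_sub_le la hXa.1 hXb.1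
  rw [norm_sub_rev xb xa] at h2
  set r := ‖xa - xb‖ with hr
  have hr0 : 0 ≤ r := norm_nonneg _
  have hε := H.ε_pos
  have hD := H.D_pos
  have hB := S.Bf_nonneg
  have h5 : (b - a) * ((S.P.f xa).toReal - (S.P.f xb).toReal) ≤ S.ε₄ * (S.Bf * r) :=
    calc _ ≤ (b - a) * (S.Bf * r) := mul_le_mul_of_nonneg_left h4 (by linarith)
      _ ≤ _ := by gcongr
  -- Sum of the two near-optimality inequalities, each tested at the other point; the `g` and
  -- proximal terms cancel.
  have h6 : S.ε * r ^ 2 ≤ S.ε₄ * (S.Bf * r) + 2 * S.ε₁ * r := by linarith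
  have h7 : r ≤ (S.Bf + 2) * S.ε / S.D := by
    rcases hr0.eq_or_lt with h0 | h0
    · rw [← h0]; positivity
    · have : r * (S.ε * r) ≤ r * (S.ε * ((S.Bf + 2) * S.ε / S.D)) := by
        have e : S.ε₄ * (S.Bf * r) + 2 * S.ε₁ * r = r * (S.ε * ((S.Bf + 2) * S.ε / S.D)) := by
          rw [ε₄, ε₁]; ring
        rw [← e]; linarith
      exact le_of_mul_le_mul_left (le_of_mul_le_mul_left this h0) hε
  have h8 : S.Bf * r ≤ S.Bf * ((S.Bf + 2) * S.ε / S.D) := by gcongr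
  have hb0 : 0 ≤ b := ha.le.trans hab
  -- The infeasibility margin `ε₂` at `xa` is subtracted from the Lipschitz loss; the remainder
  -- times `2 * Dz` is exactly `ε₃`.
  have h9 : -((S.P.f xb).toReal - S.c) ≤ (S.Bf + S.Bf ^ 2) * S.ε / S.D := by
    have e : S.Bf * ((S.Bf + 2) * S.ε / S.D) = (S.Bf + S.Bf ^ 2) * S.ε / S.D + S.ε₂ := by
      rw [ε₂]; ring
    linarith
  calc -(b * ((S.P.f xb).toReal - S.c)) = b * -((S.P.f xb).toReal - S.c) := by ring
    _ ≤ b * ((S.Bf + S.Bf ^ 2) * S.ε / S.D) := by gcongr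
    _ ≤ 2 * S.Dz * ((S.Bf + S.Bf ^ 2) * S.ε / S.D) := by gcongr
    _ = S.ε₃ := by rw [ε₃]; ring

/-- Nearly optimal, nearly feasible and nearly complementary points are `ε`-optimal. -/
lemma isEpsOptimal {z τ δ η : ℝ} {x : Sp n} (hz : 0 ≤ z) (hz' : z ≤ 2 * S.Dz) (hx : S.Near z x)
    (hf : S.NearFeasible x) (hτ : -(z * ((S.P.f x).toReal - S.c)) ≤ τ)
    (hb : ∀ r, Bornology.IsBounded (lev S.P.g r))
    (hτε : τ + (η * S.Dg + S.ε / S.Δ₁ * S.Dg) * S.ε ≤ S.ε)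
    (hδ : (1 + S.Dg ^ 2 + S.Dg / S.Δ₁) * S.ε ≤ δ) (hη : 0 ≤ η)
    (hnear : ∀ x ∈ lev S.P.g ((S.P.gBar S.c).toReal + δ), x ∈ lev S.P.f (S.c + δ) →
      ∃ s ∈ lev S.P.g (S.P.gBar S.c).toReal, s ∈ lev S.P.f S.c ∧ ‖s - x‖ ≤ η) :
    S.P.IsEpsOptimal S.c S.ε x := by
  obtain ⟨hxf, hxc⟩ := H.le_of_nearFeasible hf
  have hε := H.ε_pos
  have hΔ := H.Δ₁_pos
  have hDg := S.Dg_nonneg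
  have hx0c : S.P.f S.x0 ≤ (S.c : EReal) :=
    H.f_x0_lt.le.trans (by exact_mod_cast (by linarith : S.c - S.Δ₁ ≤ S.c))
  have hgb := H.basic.coe_gBar H.x0_mem.2 hx0c
  set gb := (S.P.gBar S.c).toReal with hgbdef
  have gb_le : gb ≤ (S.P.g S.x0).toReal := by
    have : S.P.gBar S.c ≤ S.P.g S.x0 := iInf₂_le S.x0 (EReal.sub_nonpos.2 hx0c)
    rw [← hgb, ← H.basic.g_pcl.coe_toReal H.x0_mem.2] at this
    exact_mod_cast this
  have lx := H.near_mem_lev hz hz' hx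
  -- Weak duality with errors: `f s ≤ c` reduces the multiplier terms to the complementarity error
  -- `τ`.
  have compare : ∀ s ∈ lev S.P.g gb, s ∈ lev S.P.f S.c → s ∈ lev S.P.g S.DL ∧
      (S.P.g x).toReal ≤ gb + τ + S.ε / 2 * (‖s - S.x0‖ ^ 2 - ‖x - S.x0‖ ^ 2) +
        S.ε ^ 2 / S.Δ₁ * ‖s - x‖ := by
    intro s hs hs'
    have s1 := ProperConvexLsc.mem_edom_of_le hs
    have s2 := ProperConvexLsc.mem_edom_of_le hs'
    have s3 := H.basic.g_pcl.toReal_le hs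
    have s4 := H.basic.f_pcl.toReal_le hs'
    refine ⟨H.mem_lev_DL s1 (by linarith), ?_⟩
    have s5 := hx.le s ⟨s2, s1⟩
    have s6 : S.ε₁ * ‖s - x‖ ≤ S.ε ^ 2 / S.Δ₁ * ‖s - x‖ := by
      have := H.ε₁_le
      gcongr
    have s7 : z * (S.P.f s).toReal ≤ z * S.c := by gcongr
    have s8 : 0 ≤ S.ε / 2 * ‖s - x‖ ^ 2 := by positivity
    linarith
  have hε1 := H.ε_le
  have hτ1 : τ ≤ S.ε := by
    have : 0 ≤ (η * S.Dg + S.ε / S.Δ₁ * S.Dg) * S.ε := by positivity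
    linarith
  -- First stage: an arbitrary solution gives an `O(ε)` bound, just enough to apply `hnear`. The
  -- second stage repeats the comparison with a solution close to `x`.
  have crude : (S.P.g x).toReal ≤ gb + δ := by
    obtain ⟨s, hs, hs'⟩ := H.basic.exists_solution hb H.x0_mem.2 hx0c
    obtain ⟨c1, c2⟩ := compare s hs hs'
    have c3 : ‖s - S.x0‖ ^ 2 ≤ S.Dg ^ 2 := by
      have := H.norm_sub_le_Dg c1 H.x0_mem_lev
      gcongr
    have c4 := H.norm_sub_le_Dg c1 lx
    have c5 : S.ε / 2 * (‖s - S.x0‖ ^ 2 - ‖x - S.x0‖ ^ 2) ≤ S.ε * S.Dg ^ 2 := by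
      have : S.ε * ‖s - S.x0‖ ^ 2 ≤ S.ε * S.Dg ^ 2 := by gcongr
      have : 0 ≤ S.ε * ‖x - S.x0‖ ^ 2 := by positivity
      have : 0 ≤ S.ε * S.Dg ^ 2 := by positivity
      linarith
    have c6 : S.ε ^ 2 / S.Δ₁ * ‖s - x‖ ≤ S.Dg / S.Δ₁ * S.ε := by
      calc S.ε ^ 2 / S.Δ₁ * ‖s - x‖ ≤ S.ε ^ 2 / S.Δ₁ * S.Dg := by gcongr
        _ = S.ε * (S.Dg / S.Δ₁ * S.ε) := by ring
        _ ≤ 1 * (S.Dg / S.Δ₁ * S.ε) := by gcongr; linarith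
        _ = _ := one_mul _
    linarith
  have hδε : S.ε ≤ δ := by
    have : 0 ≤ (S.Dg ^ 2 + S.Dg / S.Δ₁) * S.ε := by positivity
    linarith
  obtain ⟨s, hs, hs', hsx⟩ := hnear x (H.basic.g_pcl.le_of_toReal_le hx.mem crude)
    (H.basic.f_pcl.le_of_toReal_le hxf (by linarith [H.ε₂_le]))
  obtain ⟨c1, c2⟩ := compare s hs hs'
  have c3 := H.norm_sub_le_Dg c1 H.x0_mem_lev
  have c4 := H.norm_sub_le_Dg lx H.x0_mem_lev
  have c5 := H.norm_sub_le_Dg c1 lx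
  have c6 : ‖s - S.x0‖ - ‖x - S.x0‖ ≤ η := by
    have := norm_sub_norm_le (s - S.x0) (x - S.x0)
    rw [sub_sub_sub_cancel_right] at this
    linarith
  have c7 : ‖s - S.x0‖ ^ 2 - ‖x - S.x0‖ ^ 2 ≤ 2 * (η * S.Dg) := by
    have e : ‖s - S.x0‖ ^ 2 - ‖x - S.x0‖ ^ 2 =
      (‖s - S.x0‖ - ‖x - S.x0‖) * (‖s - S.x0‖ + ‖x - S.x0‖) := by ring
    have e1 : 0 ≤ ‖s - S.x0‖ + ‖x - S.x0‖ := by positivity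
    rw [e]
    calc _ ≤ η * (‖s - S.x0‖ + ‖x - S.x0‖) := by gcongr
      _ ≤ η * (S.Dg + S.Dg) := by gcongr
      _ = _ := by ring
  have c8 : S.ε / 2 * (‖s - S.x0‖ ^ 2 - ‖x - S.x0‖ ^ 2) ≤ S.ε / 2 * (2 * (η * S.Dg)) := by gcongr
  have c9 : S.ε ^ 2 / S.Δ₁ * ‖s - x‖ ≤ S.ε ^ 2 / S.Δ₁ * S.Dg := by gcongr
  have c10 : S.ε ^ 2 / S.Δ₁ * S.Dg = S.ε / S.Δ₁ * S.Dg * S.ε := by ring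
  constructor
  · rw [← hgb, ← H.basic.g_pcl.coe_toReal hx.mem, ← EReal.coe_sub, EReal.coe_le_coe_iff]
    linarith
  · refine hf.trans ?_
    exact_mod_cast H.ε₂_le

end Standing

end Setup

/-! ### Interval search and bisection -/

namespace Setup

/-- The invariant of the interval `[a, b]` in the bisection. -/
structure Bracket (S : Setup n) (a b : ℝ) (xb : Sp n) : Prop where
  nonneg : 0 ≤ a
  le : a ≤ b
  le_Dz : b ≤ 2 * S.Dz
  near : S.Near b xb
  feas : S.NearFeasible xb
  left : (a = b ∧ -(b * ((S.P.f xb).toReal - S.c)) ≤ S.ε₃) ∨ a = 0 ∨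
    ∃ xa, S.Near a xa ∧ ¬ S.NearFeasible xa

/-- Every admissible call of the inner method halts after at most `M` queries. -/
def CallBound (S : Setup n) (M : ℝ) : Prop :=
  ∀ (z : ℝ) (y : Sp n), 0 ≤ z → z ≤ 2 * S.Dz → y ∈ lev S.P.g S.DL →
    (∃ x N, S.Call z y x N) ∧ ∀ x N, S.Call z y x N → (N : ℝ) ≤ M

/-- Nearly optimal, nearly feasible points with complementarity error at most `τ` are
`ε`-optimal. -/
def OptBound (S : Setup n) (τ : ℝ) : Prop :=
  ∀ (z : ℝ) (x : Sp n), 0 ≤ z → z ≤ 2 * S.Dz → S.Near z x → S.NearFeasible x →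
    -(z * ((S.P.f x).toReal - S.c)) ≤ τ → S.P.IsEpsOptimal S.c S.ε x

namespace Standing

variable {S : Setup n} {Γ M τ : ℝ} (H : S.Standing Γ)
include H

/-- The end `a = 0` is separate because the point computed there may leave `dom f`, where no
Lipschitz bound holds; instead `b ≤ ε₄` makes the product with `c - f xb` tiny. -/
lemma bracket_short {a b : ℝ} {xb : Sp n} (hB : S.Bracket a b xb) (hlen : b - a ≤ S.ε₄)
    (h₃ : S.ε₃ ≤ τ) (h₄ : S.ε₄ * |S.c - S.P.fStar.toReal| ≤ τ) :
    -(b * ((S.P.f xb).toReal - S.c)) ≤ τ := by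
  have hz : a = 0 → -(b * ((S.P.f xb).toReal - S.c)) ≤ τ := by
    rintro rfl
    refine le_trans ?_ h₄
    have h1 := H.basic.fStar_le ⟨(H.le_of_nearFeasible hB.feas).1, hB.near.mem⟩
    have h2 := hB.le
    rw [sub_zero] at hlen
    calc -(b * ((S.P.f xb).toReal - S.c)) = b * (S.c - (S.P.f xb).toReal) := by ring
      _ ≤ b * |S.c - S.P.fStar.toReal| := by
          gcongr
          exact le_trans (by linarith) (le_abs_self _)
      _ ≤ _ := by gcongr
  rcases hB.left with ⟨-, h⟩ | h | ⟨xa, hxa, hfa⟩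
  · exact h.trans h₃
  · exact hz h
  · rcases hB.nonneg.eq_or_lt with h | ha
    · exact hz h.symm
    · exact (H.neg_mul_le_of_short ha hB.le hB.le_Dz hlen hxa hB.near hfa).trans h₃

/-- Every continuing pass halves a valid bracket, so `k` counts the remaining passes. An early hit
has tested complementarity directly. -/
lemma bisec (hcall : S.CallBound M) (hM : 0 ≤ M) (hopt : S.OptBound τ) (h₃ : S.ε₃ ≤ τ)
    (h₄ : S.ε₄ * |S.c - S.P.fStar.toReal| ≤ τ) (k : ℕ) {a b : ℝ} {xb x : Sp n}
    (hB : S.Bracket a b xb) (hx : x ∈ lev S.P.g S.DL) (hk : b - a ≤ 2 ^ k * S.ε₄) :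
    (∃ out z N, S.Bisec a b xb x out z N) ∧
    ∀ out z N, S.Bisec a b xb x out z N →
      S.P.IsEpsOptimal S.c S.ε out ∧ (N : ℝ) ≤ k * (M + 2) := by
  have hb0 : 0 ≤ b := hB.nonneg.trans hB.le
  induction k generalizing a b xb x with
  | zero =>
    rw [pow_zero, one_mul] at hk
    refine ⟨⟨_, _, _, .done (not_lt.2 hk)⟩, fun out z N hr => ?_⟩
    cases hr with
    | done h =>
      exact ⟨hopt b _ hb0 hB.le_Dz hB.near hB.feas (H.bracket_short hB hk h₃ h₄), by simp⟩
    | raise h => exact absurd h (not_lt.2 hk)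
    | hit h => exact absurd h (not_lt.2 hk)
    | lower h => exact absurd h (not_lt.2 hk)
  | succ k ih =>
    have hk0 : (0 : ℝ) ≤ k := Nat.cast_nonneg k
    set e := (a + b) / 2 with he
    have he0 : 0 ≤ e := by have := hB.nonneg; positivity
    have hae : a ≤ e := by have := hB.le; rw [he]; linarith
    have heb : e ≤ b := by have := hB.le; rw [he]; linarith
    have heD : e ≤ 2 * S.Dz := heb.trans hB.le_Dz
    obtain ⟨c1, c2⟩ := hcall e x he0 heD hx
    have hlen1 : b - e ≤ 2 ^ k * S.ε₄ := by rw [pow_succ] at hk; rw [he]; linarith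
    have hlen2 : e - a ≤ 2 ^ k * S.ε₄ := by rw [pow_succ] at hk; rw [he]; linarith
    have hraise : ∀ {y N}, S.Call e x y N → ¬ S.NearFeasible y →
        S.Bracket e b xb ∧ y ∈ lev S.P.g S.DL := fun hy hf =>
      have hn := H.near_of_call he0 heD hy
      ⟨⟨he0, heb, hB.le_Dz, hB.near, hB.feas, .inr (.inr ⟨_, hn, hf⟩)⟩,
        H.near_mem_lev he0 heD hn⟩
    have hlower : ∀ {y N}, S.ε₄ < b - a → S.Call e x y N → S.NearFeasible y →
        S.Bracket a e y ∧ y ∈ lev S.P.g S.DL := by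
      intro y N h hy hf
      have hn := H.near_of_call he0 heD hy
      refine ⟨⟨hB.nonneg, hae, heD, hn, hf, ?_⟩, H.near_mem_lev he0 heD hn⟩
      -- A one-point bracket never enters the loop, so its alternative need not be preserved.
      rcases hB.left with ⟨rfl, -⟩ | h'
      · rw [sub_self] at h
        exact absurd h (not_lt.2 H.ε₄_pos.le)
      · exact .inr h'
    by_cases h : S.ε₄ < b - a
    · constructor
      · obtain ⟨y, N, hy⟩ := c1
        by_cases hf : S.NearFeasible y
        · by_cases hc : S.NearCompl e y
          · exact ⟨_, _, _, .hit h hy hf hc⟩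
          · obtain ⟨b1, b2⟩ := hlower h hy hf
            obtain ⟨out, z, N', hr⟩ := (ih b1 b2 hlen2 he0).1
            exact ⟨_, _, _, .lower h hy hf hc hr⟩
        · obtain ⟨b1, b2⟩ := hraise hy hf
          obtain ⟨out, z, N', hr⟩ := (ih b1 b2 hlen1 hb0).1
          exact ⟨_, _, _, .raise h hy hf hr⟩
      · intro out z N hr
        cases hr with
        | done h' => exact absurd h h'
        | raise _ hy hf hrec =>
          obtain ⟨b1, b2⟩ := hraise hy hf
          obtain ⟨d1, d2⟩ := (ih b1 b2 hlen1 hb0).2 _ _ _ hrec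
          have d3 := c2 _ _ hy
          refine ⟨d1, ?_⟩
          push_cast
          linarith
        | hit _ hy hf hc =>
          have d3 := c2 _ _ hy
          refine ⟨hopt e _ he0 heD (H.near_of_call he0 heD hy) hf ?_, ?_⟩
          · have := ((H.nearCompl_iff (H.le_of_nearFeasible hf).1).1 hc).1
            rw [← he] at this
            linarith
          · have : 0 ≤ (k : ℝ) * (M + 2) := by positivity
            push_cast
            linarith
        | lower _ hy hf hc hrec =>
          obtain ⟨b1, b2⟩ := hlower h hy hf
          obtain ⟨d1, d2⟩ := (ih b1 b2 hlen2 he0).2 _ _ _ hrec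
          have d3 := c2 _ _ hy
          refine ⟨d1, ?_⟩
          push_cast
          linarith
    · refine ⟨⟨_, _, _, .done h⟩, fun out z N hr => ?_⟩
      cases hr with
      | done h =>
        refine ⟨hopt b _ hb0 hB.le_Dz hB.near hB.feas (H.bracket_short hB (not_lt.1 h) h₃ h₄), ?_⟩
        push_cast
        positivity
      | raise h' => exact absurd h' h
      | hit h' => exact absurd h' h
      | lower h' => exact absurd h' h

/-- Doubling happens only at an infeasible point with `b ≤ Dz`: that point certifies the new left
end, and `2 * b ≤ 2 * Dz`. Leaving because `b > Dz` also yields feasibility, by the multiplier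
bound. -/
lemma bracket_of_loop (hcall : S.CallBound M) {a b : ℝ} {x : Sp n} (ha : 0 ≤ a) (hab : a ≤ b)
    (hb : 0 < b) (hbD : b ≤ 2 * S.Dz) (hx : S.Near b x)
    (hl : a = 0 ∨ ∃ xa, S.Near a xa ∧ ¬ S.NearFeasible xa) :
    (∃ a' b' x', S.IntVLoop a b x a' b' x') ∧
    ∀ a' b' x', S.IntVLoop a b x a' b' x' → S.Bracket a' b' x' := by
  obtain ⟨j, hj⟩ := pow_unbounded_of_one_lt (S.Dz / b) (one_lt_two (α := ℝ))
  rw [div_lt_iff₀ hb] at hj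
  have exit : ∀ {a b x}, 0 ≤ a → a ≤ b → b ≤ 2 * S.Dz → S.Near b x →
      (a = 0 ∨ ∃ xa, S.Near a xa ∧ ¬ S.NearFeasible xa) → ¬ (¬ S.NearFeasible x ∧ b ≤ S.Dz) →
      S.Bracket a b x := by
    intro a b x ha hab hbD hx hl h
    refine ⟨ha, hab, hbD, hx, ?_, .inr hl⟩
    by_contra hf
    exact h ⟨hf, not_lt.1 fun hlt => hf (H.nearFeasible_of_Dz_lt hlt hx)⟩
  induction j generalizing a b x with
  | zero =>
    have h : ¬ (¬ S.NearFeasible x ∧ b ≤ S.Dz) := fun h => by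
      rw [pow_zero, one_mul] at hj
      exact absurd hj (not_lt.2 h.2)
    refine ⟨⟨_, _, _, .exit h⟩, fun a' b' x' hr => ?_⟩
    cases hr with
    | exit h => exact exit ha hab hbD hx hl h
    | double h' => exact absurd h' h
  | succ j ih =>
    by_cases h : ¬ S.NearFeasible x ∧ b ≤ S.Dz
    · have h2 : 2 * b ≤ 2 * S.Dz := by linarith [h.2]
      have next : ∀ {y N}, S.Call (2 * b) x y N →
          (∃ a' b' x', S.IntVLoop b (2 * b) y a' b' x') ∧
          ∀ a' b' x', S.IntVLoop b (2 * b) y a' b' x' → S.Bracket a' b' x' := fun hy =>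
        ih hb.le (by linarith) (by positivity) h2 (H.near_of_call (by positivity) h2 hy)
          (.inr ⟨x, hx, h.1⟩) (by rw [pow_succ] at hj; linarith)
      constructor
      · obtain ⟨y, N, hy⟩ := (hcall (2 * b) x (by positivity) h2 (H.near_mem_lev hb.le hbD hx)).1
        obtain ⟨a', b', x', hr⟩ := (next hy).1
        exact ⟨_, _, _, .double h hy hr⟩
      · intro a' b' x' hr
        cases hr with
        | exit h' => exact absurd h h'
        | double _ hy hr => exact (next hy).2 _ _ _ hr
    · refine ⟨⟨_, _, _, .exit h⟩, fun a' b' x' hr => ?_⟩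
      cases hr with
      | exit h => exact exit ha hab hbD hx hl h
      | double h' => exact absurd h' h

lemma bracket_of_intV (hcall : S.CallBound M) {σ : ℝ} (hσ : 0 < σ) (hσD : σ ≤ 2 * S.Dz) {y₀ : Sp n}
    (hy₀ : y₀ ∈ lev S.P.g S.DL) :
    (∃ a b xb, S.IntV σ y₀ a b xb) ∧ ∀ a b xb, S.IntV σ y₀ a b xb → S.Bracket a b xb := by
  have hD : (0 : ℝ) ≤ 2 * S.Dz := hσ.le.trans hσD
  have loop : ∀ {x y N M}, S.Call 0 y₀ x N → S.Call σ x y M → _ := fun {x y N M} _ hy =>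
    H.bracket_of_loop hcall le_rfl hσ.le hσ hσD (H.near_of_call hσ.le hσD hy) (.inl rfl)
  constructor
  · obtain ⟨x, N, hx⟩ := (hcall 0 y₀ le_rfl hD hy₀).1
    by_cases hf : S.NearFeasible x
    · exact ⟨_, _, _, .zero hx hf⟩
    · obtain ⟨y, N', hy⟩ := (hcall σ x hσ.le hσD
        (H.near_mem_lev le_rfl hD (H.near_of_call le_rfl hD hx))).1
      obtain ⟨a, b, xb, hl⟩ := (loop hx hy).1
      by_cases hc : S.NearCompl b xb
      · exact ⟨_, _, _, .point hx hf hy hl hc⟩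
      · exact ⟨_, _, _, .interval hx hf hy hl hc⟩
  · intro a b xb hr
    cases hr with
    | zero hx hf =>
      exact ⟨le_rfl, le_rfl, hD, H.near_of_call le_rfl hD hx, hf, .inr (.inl rfl)⟩
    | point hx hf hy hl hc =>
      have hB := (loop hx hy).2 _ _ _ hl
      refine ⟨hB.nonneg.trans hB.le, le_rfl, hB.le_Dz, hB.near, hB.feas, .inl ⟨rfl, ?_⟩⟩
      have := ((H.nearCompl_iff (H.le_of_nearFeasible hB.feas).1).1 hc).1
      linarith
    | interval hx hf hy hl hc => exact (loop hx hy).2 _ _ _ hl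

end Standing

end Setup

/-! ### Complexity -/

lemma one_sub_pow_le_exp {q : ℝ} (hq : q ≤ 1) (j : ℕ) : (1 - q) ^ j ≤ Real.exp (-(j * q)) := by
  have h1 : 1 - q ≤ Real.exp (-q) := by
    have := Real.add_one_le_exp (-q)
    linarith
  calc (1 - q) ^ j ≤ Real.exp (-q) ^ j := by
        have : 0 ≤ 1 - q := by linarith
        gcongr
    _ = _ := by rw [← Real.exp_nat_mul]; ring_nf

lemma search_cost_le {ℓ T W k : ℝ} (hℓ : 1 ≤ ℓ) (hT : 1 ≤ T) (hW : 0 ≤ W) (hk : k ≤ 5 * ℓ + 1) :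
    k * ((5 * ℓ * T + 3) * W + 2) ≤ 6 * ℓ * (ℓ * T * (8 * W + 2)) := by
  have hℓT : 1 ≤ ℓ * T := one_le_mul_of_one_le_of_one_le hℓ hT
  have h1 : (5 * ℓ * T + 3) * W + 2 ≤ ℓ * T * (8 * W + 2) := by
    have : 0 ≤ (ℓ * T - 1) * W := mul_nonneg (by linarith) hW
    nlinarith
  have h2 : 0 ≤ (5 * ℓ * T + 3) * W + 2 := by positivity
  calc k * ((5 * ℓ * T + 3) * W + 2) ≤ 6 * ℓ * ((5 * ℓ * T + 3) * W + 2) :=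
        mul_le_mul_of_nonneg_right (by linarith) h2
    _ ≤ _ := mul_le_mul_of_nonneg_left h1 (by positivity)

/-- The constant of the complexity bound. -/
def complexityConst (γ₁ r : ℝ) : ℝ :=
  6 * (8 * (8 * (1 + Real.log (r ^ 2) / Real.log γ₁) + 1) + 2) * √r

lemma complexityConst_pos {γ₁ r : ℝ} (hγ₁ : 1 < γ₁) (hr : 1 < r) : 0 < complexityConst γ₁ r := by
  have h1 := Real.log_pos hγ₁
  have h2 : 0 < Real.log (r ^ 2) := Real.log_pos (by nlinarith)
  have h3 : 0 < √r := Real.sqrt_pos.2 (by linarith)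
  rw [complexityConst]
  positivity

namespace Setup

namespace Standing

variable {S : Setup n} {Γ τ : ℝ} (H : S.Standing Γ)
include H

/-- With `ℓ = |log ε|` and `T = √(r * Lphi / ε)`, a call costs `O(ℓ T)` and there are `O(ℓ)` passes.
The smallness conditions trade one power of `ε` for each problem-dependent constant, which keeps
those constants out of the final bound. -/
lemma search {p : Sp n} (hp : p ∈ S.P.solG) {r : ℝ} (hr : S.γ₁ ≤ r) (hρ : S.Lphi ≤ r * S.Lmin)
    (hρ' : S.Lmin ≤ r * S.Lphi) (hε : S.ε ≤ 1 / 3)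
    (hK : 32 * (Γ - (S.P.g p).toReal + 4 * S.Dz * (|S.P.fStar.toReal| + 1) +
      r * S.Lphi / 2 * S.Dg ^ 2) * (r * S.Lphi) ^ 2 / S.Lmin * S.D ^ 2 * S.ε ≤ 1)
    (hk : 2 * S.Dz * S.D * S.ε ≤ 1)
    (hopt : S.OptBound τ) (h₃ : S.ε₃ ≤ τ) (h₄ : S.ε₄ * |S.c - S.P.fStar.toReal| ≤ τ)
    {σ : ℝ} {y₀ y₁ : Sp n} (hσ : 0 < σ) (hσD : σ ≤ 2 * S.Dz) (hy₀ : y₀ ∈ lev S.P.g S.DL)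
    (hy₁ : y₁ ∈ lev S.P.g S.DL) :
    (∃ a b xb, S.IntV σ y₀ a b xb) ∧ ∀ a b xb, S.IntV σ y₀ a b xb →
      (∃ x z N, S.Bisec a b xb y₁ x z N) ∧ ∀ x z N, S.Bisec a b xb y₁ x z N →
        S.P.IsEpsOptimal S.c S.ε x ∧
        (N : ℝ) ≤ complexityConst S.γ₁ r * √(S.Lphi / S.ε) * |Real.log S.ε| ^ 2 := by
  have hε0 := H.ε_pos
  have hm : 0 < S.Lmin := hε0.trans_le H.ε_le_Lmin
  have hD := H.D_pos
  have hDz := H.Dz_pos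
  have hL1 := H.one_le_Lphi
  have hr1 : 1 < r := H.one_lt.trans_le hr
  have hγlog := Real.log_pos H.one_lt
  set Lbar := r * S.Lphi with hLbar
  have hLbar1 : 1 ≤ Lbar := by rw [hLbar]; nlinarith
  set ℓ := -Real.log S.ε with hℓ
  have hℓ1 : 1 ≤ ℓ := by
    have h1 : Real.exp 1 ≤ 1 / S.ε := by
      have h2 := Real.exp_one_lt_d9
      rw [le_div_iff₀ hε0]
      nlinarith
    have h3 := (Real.le_log_iff_exp_le (by positivity)).2 h1
    rwa [one_div, Real.log_inv] at h3
  have hexp : Real.exp (-ℓ) = S.ε := by rw [hℓ, neg_neg, Real.exp_log hε0]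
  set T := √(Lbar / S.ε) with hT
  have hT1 : 1 ≤ T := by
    rw [hT, Real.one_le_sqrt, one_le_div hε0]
    linarith
  have hTinv : √(S.ε / Lbar) * T = 1 := by
    rw [hT, ← Real.sqrt_mul (by positivity), div_mul_div_comm, mul_comm S.ε, div_self (by positivity),
      Real.sqrt_one]
  have hq1 : √(S.ε / Lbar) ≤ 1 := Real.sqrt_le_one.2 ((div_le_one (by positivity)).2 (by linarith))
  set W := 8 * (1 + Real.log (r ^ 2) / Real.log S.γ₁) + 1 with hW
  have hW0 : 0 ≤ W := by
    have h2 : 0 < Real.log (r ^ 2) := Real.log_pos (by nlinarith)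
    positivity
  -- the cost of a call
  set j := ⌈5 * ℓ * T⌉₊ with hj
  have hj1 : 5 * ℓ * T ≤ j := Nat.le_ceil _
  have hj2 : (j : ℝ) ≤ 5 * ℓ * T + 1 := (Nat.ceil_lt_add_one (by positivity)).le
  -- Four powers of `ε` for `ε₁ ^ 2 = ε ^ 4 / D ^ 2`, and one to absorb the constants through `hK`.
  have hpow : (1 - √(S.ε / Lbar)) ^ (j + 1) ≤ S.ε ^ 5 := by
    have h0 : S.ε ^ 5 = Real.exp (5 * -ℓ) := by
      rw [← hexp, ← Real.exp_nat_mul]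
      push_cast
      rfl
    rw [h0]
    refine (one_sub_pow_le_exp hq1 _).trans ?_
    apply Real.exp_le_exp.2
    have h1 : 5 * ℓ * T * √(S.ε / Lbar) ≤ ((j + 1 : ℕ) : ℝ) * √(S.ε / Lbar) := by
      push_cast
      gcongr
      linarith
    have h2 : 5 * ℓ * T * √(S.ε / Lbar) = 5 * ℓ := by
      rw [mul_assoc, mul_comm T, hTinv, mul_one]
    push_cast at *
    linarith
  have hcall : S.CallBound ((5 * ℓ * T + 3) * W) := by
    intro z y hz hz' hy
    set K := 32 * (Γ - (S.P.g p).toReal + 4 * S.Dz * (|S.P.fStar.toReal| + 1) +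
      Lbar / 2 * S.Dg ^ 2) * Lbar ^ 2 / S.Lmin with hKdef
    have hK0 : 0 ≤ K := by
      have h1 := H.basic.solG_le hp H.x0_mem.2
      have h2 := H.g_x0_le
      have h3 : 0 ≤ Γ - (S.P.g p).toReal := by linarith
      positivity
    obtain ⟨c1, c2⟩ := H.call hp hz hz' hρ'
      (mul_le_mul_of_nonneg_right hr (by linarith)) hy j (by
      rw [← hKdef]
      calc (1 - √(S.ε / Lbar)) ^ (j + 1) * K ≤ S.ε ^ 5 * K := by gcongr
        _ = S.ε ^ 4 / S.D ^ 2 * (K * S.D ^ 2 * S.ε) := by field_simp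
        _ ≤ S.ε ^ 4 / S.D ^ 2 * 1 := by gcongr
        _ = S.ε₁ ^ 2 := by rw [ε₁, div_pow, mul_one]; ring)
    refine ⟨c1, fun x N hx => (c2 x N hx).trans ?_⟩
    have h1 : Real.log (Lbar / S.Lmin) ≤ Real.log (r ^ 2) := by
      apply Real.log_le_log (by positivity)
      rw [div_le_iff₀ hm, hLbar]
      nlinarith
    have h2 : 8 * (1 + Real.log (Lbar / S.Lmin) / Real.log S.γ₁) + 1 ≤ W := by
      rw [hW]; gcongr
    calc ((j : ℝ) + 2) * (8 * (1 + Real.log (Lbar / S.Lmin) / Real.log S.γ₁) + 1)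
        ≤ ((j : ℝ) + 2) * W := by gcongr
      _ ≤ _ := mul_le_mul_of_nonneg_right (by linarith) hW0
  -- the number of bisection steps
  set k := ⌈5 * ℓ⌉₊ with hkdef
  have hk1 : 5 * ℓ ≤ k := Nat.le_ceil _
  have hk2 : (k : ℝ) ≤ 5 * ℓ + 1 := (Nat.ceil_lt_add_one (by positivity)).le
  have hk3 : 2 * S.Dz ≤ 2 ^ k * S.ε₄ := by
    -- Holds since `5 * log 2 > 3`. Two powers of `ε` compensate `ε₄`, and the third absorbs `2 * Dz
    -- * D` through `hk`.
    have h1 : (S.ε ^ 3)⁻¹ ≤ 2 ^ k := by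
      rw [← hexp, ← Real.exp_nat_mul, ← Real.exp_neg]
      have h2 : (2 : ℝ) ^ k = Real.exp (k * Real.log 2) := by
        rw [Real.exp_nat_mul, Real.exp_log two_pos]
      rw [h2]
      apply Real.exp_le_exp.2
      have h3 := Real.log_two_gt_d9
      push_cast
      nlinarith
    calc 2 * S.Dz = 2 * S.Dz * S.D * S.ε * ((S.ε ^ 3)⁻¹ * (S.ε ^ 2 / S.D)) := by field_simp
      _ ≤ 1 * ((S.ε ^ 3)⁻¹ * (S.ε ^ 2 / S.D)) := by gcongr
      _ ≤ 1 * (2 ^ k * (S.ε ^ 2 / S.D)) := by gcongr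
      _ = _ := by rw [one_mul, ε₄]
  obtain ⟨e1, e2⟩ := H.bracket_of_intV hcall hσ hσD hy₀
  refine ⟨e1, fun a b xb hr => ?_⟩
  have hB := e2 a b xb hr
  obtain ⟨f1, f2⟩ := H.bisec hcall (by positivity) hopt h₃ h₄ k hB hy₁
    (le_trans (by linarith [hB.nonneg, hB.le_Dz]) hk3)
  refine ⟨f1, fun x z N hrun => ?_⟩
  obtain ⟨g1, g2⟩ := f2 x z N hrun
  refine ⟨g1, g2.trans ?_⟩
  have hTeq : T = √r * √(S.Lphi / S.ε) := by
    rw [hT, hLbar, mul_div_assoc, Real.sqrt_mul (by linarith)]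
  have habs : |Real.log S.ε| ^ 2 = ℓ ^ 2 := by rw [hℓ, sq_abs, neg_sq]
  have hfin : complexityConst S.γ₁ r * √(S.Lphi / S.ε) * |Real.log S.ε| ^ 2 =
      6 * ℓ * (ℓ * T * (8 * W + 2)) := by
    rw [habs, complexityConst, hTeq]; ring
  rw [hfin]
  exact search_cost_le hℓ1 hT1 hW0 hk2

end Standing

/-! ### Uniformity of the derived constants -/

namespace Regular

/-- Bounds for the derived constants that do not depend on the accuracy, `x⁰` and `x̃_g`. -/
lemma exists_uniform {P : Problem n} (hP : P.Basic) (hb : ∀ r, Bornology.IsBounded (lev P.g r))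
    (γ₁ Δ₁ Γ : ℝ) : ∃ Zm Rm Dm Lm : ℝ, ∀ S : Setup n, S.P = P → S.γ₁ = γ₁ → S.Δ₁ = Δ₁ →
      S.Regular Γ → S.Dz ≤ Zm ∧ S.Dg ≤ Rm ∧ S.D ≤ Dm ∧ S.Lphi ≤ Lm := by
  set Zm := (Γ - P.gStar.toReal + 1) / Δ₁ with hZm
  obtain ⟨U, hU0, hU⟩ := hP.exists_abs_f_le (hb (P.gStar.toReal + 1))
  set D0m := Γ + 2 * Zm * |P.fStar.toReal| + 2 * Zm * U with hD0m
  set R1m := Metric.diam (lev P.g D0m) with hR1m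
  set Lm := P.Lg₁ + 2 * Zm * P.Lf₁ + 1 with hLm
  set DLm := D0m + γ₁ * Lm * R1m ^ 2 with hDLm
  set Rm := Metric.diam (lev P.g DLm) with hRm
  set Bm := sSup ((fun x => ‖gradient P.f₁ x‖) '' lev P.g DLm) + P.lf₂ with hBm
  refine ⟨Zm, Rm, (1 + Rm * (1 + Rm)) * max Bm (2 * Zm * Bm + 2 * Zm * Bm ^ 2), Lm, ?_⟩
  intro S hSP hSγ hSΔ H
  have hΔ := H.Δ₁_pos
  have hDz := H.Dz_pos
  have hγ := H.one_lt
  have hDz' : S.Dz ≤ Zm := by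
    have h1 := H.basic.gStar_le H.xg_mem
    have h2 := H.g_x0_le
    rw [Dz, hZm, ← hSΔ, ← hSP]
    gcongr
  have hZ0 : 0 ≤ Zm := hDz.le.trans hDz'
  have hLphi : S.Lphi ≤ Lm := by
    rw [Lphi, hLm, hSP]; gcongr
  have hL1 := H.one_le_Lphi
  have hD₀ : S.D₀ ≤ D0m := by
    have h1 : |S.u₀| ≤ U := by
      rw [u₀, hSP]
      refine hU S.xg ?_ (by rw [← hSP]; exact H.xg_mem.1)
      refine lev_mono P.g (r := P.gStar.toReal + S.ε) (by linarith [H.ε_le]) ?_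
      have := H.xg_le
      rw [hSP] at this
      exact this
    have h2 := H.g_x0_le
    have h3 : max 0 (-2 * S.Dz * S.P.fStar.toReal) ≤ 2 * Zm * |P.fStar.toReal| := by
      refine max_le (by positivity) ?_
      have := neg_abs_le P.fStar.toReal
      calc -2 * S.Dz * S.P.fStar.toReal = 2 * S.Dz * -P.fStar.toReal := by rw [hSP]; ring
        _ ≤ 2 * S.Dz * |P.fStar.toReal| := by gcongr; linarith
        _ ≤ _ := by gcongr
    have h4 : 2 * S.Dz * |S.u₀| ≤ 2 * Zm * U := by gcongr
    rw [D₀]; linarith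
  have hR₁ : S.R₁ ≤ R1m := by
    rw [R₁, hSP]; exact Metric.diam_mono (lev_mono _ hD₀) (hb _)
  have hDL : S.DL ≤ DLm := by
    have : 0 ≤ S.R₁ := Metric.diam_nonneg
    rw [DL, hDLm, ← hSγ]
    have : 0 ≤ Lm := by linarith
    gcongr
  have hDg : S.Dg ≤ Rm := by
    rw [Dg, hSP]; exact Metric.diam_mono (lev_mono _ hDL) (hb _)
  have hBf : S.Bf ≤ Bm := by
    have h1 := H.x0_mem_lev
    rw [hSP] at h1
    rw [Bf, hSP, hBm]
    gcongr
    · exact hP.bddAbove_gradient (hb _)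
    · exact ⟨_, S.x0, h1, rfl⟩
    · exact lev_mono _ hDL
  refine ⟨hDz', hDg, ?_, hLphi⟩
  have h1 := S.Dg_nonneg
  have h2 := S.Bf_nonneg
  have h3 : 0 ≤ Bm := h2.trans hBf
  have h4 : 0 ≤ Rm := h1.trans hDg
  rw [D]
  gcongr

end Regular

end Setup

lemma eventually_mul_lt (K : ℝ) {b : ℝ} (hb : 0 < b) : ∀ᶠ ε in nhds (0 : ℝ), K * ε < b := by
  have : Filter.Tendsto (fun ε : ℝ => K * ε) (nhds 0) (nhds (K * 0)) :=
    (continuous_const.mul continuous_id).tendsto 0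
  rw [mul_zero] at this
  exact this.eventually (gt_mem_nhds hb)

end SimpleBilevel

end

/-! ### The complexity theorem: choice of the accuracy threshold -/

theorem corollary1 (γ₁ γ₂ ρ : ℝ) (hγ₁ : 1 < γ₁) (hγ₂ : 1 ≤ γ₂) :
    -- the constant of the complexity bound
    ∃ C : ℝ, 0 < C ∧
    ∀ (n : ℕ) (P : Problem n), P.Basic →
    ∀ (Lmin c Δ₁ Γ : ℝ), 0 < Lmin → 0 < Δ₁ →
    -- for all sufficiently small accuracies
    ∃ εbar : ℝ, 0 < εbar ∧
    ∀ (ε : ℝ) (x0 xg : Sp n), 0 < ε → ε ≤ εbar →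
    ∀ S : Setup n,
      S = { P := P, γ₁ := γ₁, γ₂ := γ₂, Lmin := Lmin, c := c, Δ₁ := Δ₁, ε := ε,
            x0 := x0, xg := xg } →
      S.Admissible Γ →
      S.Lphi ≤ ρ * Lmin → Lmin ≤ ρ * S.Lphi →
      ∀ (σ : ℝ) (y₀ y₁ : Sp n), 0 < σ → σ ≤ 2 * S.Dz →
        y₀ ∈ lev P.g S.DL → y₁ ∈ lev P.g S.DL →
        -- the interval search returns an interval `[a, b]`, and for every such interval
        -- bisection started at `y₁` halts with an `ε`-optimal solution within the bound
        (∃ (a b : ℝ) (xb : Sp n), S.IntV σ y₀ a b xb) ∧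
        ∀ (a b : ℝ) (xb : Sp n), S.IntV σ y₀ a b xb →
          (∃ (x : Sp n) (z : ℝ) (N : ℕ), S.Bisec a b xb y₁ x z N) ∧
          ∀ (x : Sp n) (z : ℝ) (N : ℕ), S.Bisec a b xb y₁ x z N →
            P.IsEpsOptimal c ε x ∧
            (N : ℝ) ≤ C * √((P.Lg₁ + 2 * S.Dz * P.Lf₁ + 1) / ε) * |Real.log ε| ^ 2 := by
  -- Makes `r * Lphi` dominate both `Lmin` and `γ₁ * Lphi`, hence every accepted constant.
  set r := max ρ γ₁ with hr
  have hr1 : 1 < r := hγ₁.trans_le (le_max_right _ _)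
  refine ⟨complexityConst γ₁ r, complexityConst_pos hγ₁ hr1, ?_⟩
  intro n P hP Lmin c Δ₁ Γ hLmin hΔ₁
  -- without admissible data there is nothing to prove
  by_cases hex : ∃ S : Setup n, S.P = P ∧ S.Regular Γ
  swap
  · refine ⟨min (1 / 2) Lmin, lt_min (by norm_num) hLmin, ?_⟩
    intro ε x0 xg hε hεbar S hS hA
    refine absurd ⟨S, ?_⟩ hex
    subst hS
    exact ⟨rfl, hP, hA, hγ₁, hγ₂, hΔ₁, hε, hεbar.trans (min_le_left _ _),
      hεbar.trans (min_le_right _ _)⟩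
  obtain ⟨p, hp, q, hq, hpq⟩ := hP.solG_nontrivial
  -- One admissible choice of data provides a bounded level set strictly above the minimum of `g`;
  -- convexity extends boundedness to all levels.
  have hb : ∀ r, Bornology.IsBounded (lev P.g r) := by
    obtain ⟨S, rfl, H⟩ := hex
    refine H.basic.isBounded_lev hp (lt_of_lt_of_le ?_ H.add_one_le_D₀) H.adm.bdd₀
    linarith [H.basic.solG_le hp H.x0_mem.2]
  obtain ⟨Zm, Rm, Dm, Lm, hunif⟩ := Setup.Regular.exists_uniform hP hb γ₁ Δ₁ Γ
  -- Two minimizers of `g` lie in every level set considered, so `d ≤ Dg` for all data. The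
  -- complementarity error then uses at most `ε / (1 + d)`, and the share `κ * ε` is left: half for
  -- the regularization, half for the inexact inner solution.
  set d := ‖p - q‖ with hd
  have hd0 : 0 < d := norm_pos_iff.2 (sub_ne_zero.2 hpq)
  set κ := d / (1 + d) with hκ
  have hκ0 : 0 < κ := by positivity
  set η := κ / (2 * (|Rm| + 1)) with hη
  have hη0 : 0 < η := by positivity
  obtain ⟨δ, hδ0, hδ⟩ := hP.exists_solution_near hb c (P.gBar c).toReal hη0
  set K := 32 * (Γ - (P.g p).toReal + 4 * Zm * (|P.fStar.toReal| + 1) + r * Lm / 2 * Rm ^ 2) *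
    (r * Lm) ^ 2 / Lmin * Dm ^ 2 with hK
  -- In order: `ε < 1/3`, `ε < Lmin`, the condition of `Standing`, the inner iteration count, the
  -- number of bisection passes, the crude optimality bound, the inexactness share `κ / 2`, and
  -- complementarity when `a = 0`.
  have ev := (((((((eventually_mul_lt 1 (show (0 : ℝ) < 1 / 3 by norm_num)).and
    (eventually_mul_lt 1 hLmin)).and
    (eventually_mul_lt (2 * Zm + 1 / Δ₁ ^ 2) (show (0 : ℝ) < 1 / 4 by norm_num))).and
    (eventually_mul_lt K one_pos)).and
    (eventually_mul_lt (2 * Zm * Dm) one_pos)).and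
    (eventually_mul_lt (1 + Rm ^ 2 + Rm / Δ₁) hδ0)).and
    (eventually_mul_lt (Rm / Δ₁) (half_pos hκ0))).and
    (eventually_mul_lt (|c - P.fStar.toReal| * (1 + d) / Δ₁) one_pos)
  obtain ⟨e, he0, he⟩ := Metric.eventually_nhds_iff.1 ev
  refine ⟨e / 2, half_pos he0, ?_⟩
  intro ε x0 xg hε hεe S hS hA hρ hρ' σ y₀ y₁ hσ hσD hy₀ hy₁
  obtain ⟨⟨⟨⟨⟨⟨⟨s1, s2⟩, s3⟩, s4⟩, s5⟩, s6⟩, s7⟩, s8⟩ := he (y := ε) (by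
    rw [Real.dist_eq, sub_zero, abs_of_pos hε]; linarith)
  rw [one_mul] at s1 s2
  have eP : S.P = P := by rw [hS]
  have eγ : S.γ₁ = γ₁ := by rw [hS]
  have eγ₂ : S.γ₂ = γ₂ := by rw [hS]
  have eL : S.Lmin = Lmin := by rw [hS]
  have ec : S.c = c := by rw [hS]
  have eΔ : S.Δ₁ = Δ₁ := by rw [hS]
  have eε : S.ε = ε := by rw [hS]
  clear hS
  subst eP eγ eγ₂ eL ec eΔ eε
  have HR : S.Regular Γ := ⟨hP, hA, hγ₁, hγ₂, hΔ₁, hε, by linarith, s2.le⟩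
  obtain ⟨u1, u2, u3, u4⟩ := hunif S rfl rfl rfl HR
  have hDz := HR.Dz_pos
  have hL1 := HR.one_le_Lphi
  have hD := HR.D_pos
  have hDg := S.Dg_nonneg
  have hRm : 0 ≤ Rm := hDg.trans u2
  have hZm : 0 ≤ Zm := hDz.le.trans u1
  have hLm : 0 ≤ Lm := by linarith
  have hDm : 0 ≤ Dm := hD.le.trans u3
  have H : S.Standing Γ := ⟨HR, le_trans (by gcongr) s3.le⟩
  have hdDg : d ≤ S.Dg := by
    have mem : ∀ w ∈ S.P.solG, w ∈ lev S.P.g S.DL := fun w hw =>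
      HR.mem_lev_DL (hP.solG_edom hw) (by linarith [hP.solG_le hw HR.x0_mem.2])
    exact HR.norm_sub_le_Dg (mem p hp) (mem q hq)
  have h₃ : S.ε₃ ≤ S.ε / (1 + d) := by
    rw [le_div_iff₀ (by positivity)]
    refine le_trans (mul_le_mul_of_nonneg_left ?_ HR.ε₃_nonneg) HR.ε₃_mul_le
    have := mul_nonneg hDg hDg
    linarith
  have h₄ : S.ε₄ * |S.c - S.P.fStar.toReal| ≤ S.ε / (1 + d) := by
    rw [le_div_iff₀ (by positivity)]
    calc S.ε₄ * |S.c - S.P.fStar.toReal| * (1 + d)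
        ≤ S.ε ^ 2 / S.Δ₁ * |S.c - S.P.fStar.toReal| * (1 + d) := by
          have := HR.ε₄_le
          gcongr
      _ = S.ε * (|S.c - S.P.fStar.toReal| * (1 + d) / S.Δ₁ * S.ε) := by ring
      _ ≤ S.ε * 1 := by gcongr
      _ = S.ε := mul_one _
  have hηD : η * S.Dg ≤ κ / 2 := by
    calc η * S.Dg ≤ η * (|Rm| + 1) := by
          gcongr
          linarith [le_abs_self Rm]
      _ = κ / 2 := by rw [hη]; field_simp
  have hopt : S.OptBound (S.ε / (1 + d)) := by
    intro z x hz hz' hx hf hc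
    refine H.isEpsOptimal hz hz' hx hf hc hb ?_ ?_ hη0.le hδ
    · have t1 : S.ε / S.Δ₁ * S.Dg ≤ κ / 2 := by
        calc S.ε / S.Δ₁ * S.Dg ≤ S.ε / S.Δ₁ * Rm := by gcongr
          _ = Rm / S.Δ₁ * S.ε := by ring
          _ ≤ _ := s7.le
      have t2 : (η * S.Dg + S.ε / S.Δ₁ * S.Dg) * S.ε ≤ κ * S.ε := by
        gcongr
        linarith
      have t3 : S.ε / (1 + d) + κ * S.ε = S.ε := by rw [hκ]; field_simp
      linarith
    · refine le_trans ?_ s6.le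
      gcongr
  refine H.search hp (r := r) (le_max_right _ _) (hρ.trans ?_) (hρ'.trans ?_) s1.le ?_ ?_ hopt h₃ h₄
    hσ hσD hy₀ hy₁
  · gcongr
    exact le_max_left _ _
  · gcongr
    exact le_max_left _ _
  · refine le_trans ?_ s4.le
    have t1 : 0 ≤ Γ - (S.P.g p).toReal := by
      linarith [hP.solG_le hp HR.x0_mem.2, HR.g_x0_le]
    have hr0 : 0 ≤ r := by linarith
    rw [hK]
    gcongr
  · refine le_trans ?_ s5.le
    gcongr
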